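/- **Definitions.** Let $\alpha\le\beta$ be ordinals. $\mathsf{CA}_\alpha$ is the class of cylindric algebras of dimension $\alpha$ (in the sense of Henkin, Monk and Tarski), and $\mathsf{SC}_\alpha$ the class of Pinter's substitution algebras of dimension $\alpha$: Boolean algebras with unary operations $c_i$ and $s^i_j$ $(i,j<\alpha)$ such that, for all $i,j,k,l<\alpha$: $c_i0=0$, $x\le c_ix$, $c_i(x\cdot c_iy)=c_ix\cdot c_iy$, $c_ic_jx=c_jc_ix$; $s^i_ix=x$; $s^i_j$ is a Boolean endomorphism; $s^i_jc_ix=c_ix$; $c_is^i_jx=s^i_jx$ if $i\ne j$; $s^i_jc_kx=c_ks^i_jx$ if $k\notin\{i,j\}$; $c_is^j_ix=c_js^i_jx$; $s^j_is^l_kx=s^l_ks^j_ix$ if $|\{i,j,k,l\}|=4$; $s^l_is^j_lx=s^l_is^j_ix$. For $\mathfrak B$ in $\mathsf{CA}_\beta$ or $\mathsf{SC}_\beta$, the neat reduct $\mathfrak{Nr}_\alpha\mathfrak B$ is the algebra of dimension $\alpha$ with universe $\{x: c_kx=x\text{ for all }\alpha\le k<\beta\}$ and the operations of $\mathfrak B$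 with indices below $\alpha$; $\mathsf{Nr}_\alpha\mathsf{CA}_\beta$ and $\mathsf{Nr}_\alpha\mathsf{SC}_\beta$ are the classes of algebras isomorphic to such neat reducts. The atom structure $\mathsf{At}\,\mathfrak A$ of $\mathfrak A\in\mathsf{CA}_\alpha$ is the set of atoms of $\mathfrak A$ with the relations $T_i=\{(a,b): a\le c_ib\}$ and $E_{ij}=\{a: a\le d_{ij}\}$ for $i,j<\alpha$. An algebra $\mathfrak A\in\mathsf{CA}_\alpha$ is based on a structure $S$ of this type if $\mathfrak A$ is atomic and $\mathsf{At}\,\mathfrak A\cong S$. $S$ is *weakly neat* if some algebra based on $S$ is in $\mathsf{Nr}_\alpha\mathsf{CA}_{\alpha+\omega}$, and *strongly neat* if every algebra based on $S$ is in $\mathsf{Nr}_\alpha\mathsf{CA}_{\alpha+\omega}$. **Theorem.** For every ordinal $\alpha>1$ there is a weakly neat atom structure of dimension $\alpha$ that is not strongly neat. More precisely, let $\alpha>1$ be an ordinal, $F$ a field of characteristic $0$, and let $V$ be the set of all sequences $s\in{}^\alpha F$ with $\{i<\alpha: s_i\neq 0\}$ finite. Let $$y=\Big\{s\in V: s_0+1=\sum_{0<i<\alpha}s_i\Big\},\qquad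 w=\Big\{s\in V: s_0+2=s_1+2\sum_{1<i<\alpha}s_i\Big\},$$ and let $\mathfrak A$ be the algebra generated by $\{y\}\cup\{\{s\}:s\in y\}$ in the full quasi-polyadic equality set algebra with unit $V$, that is, with universe $\wp(V)$, the Boolean set operations, the cylindrifications $c_iX=\{s\in V:\exists t\in X\ \forall j\ne i\ (s_j=t_j)\}$, the diagonals $d_{ij}=\{s\in V: s_i=s_j\}$, the replacements $s^i_jX=\{s\in V: s\circ[i|j]\in X\}$ and the transpositions $s_{[i,j]}X=\{s\in V: s\circ[i,j]\in X\}$, where $[i|j]$ maps $i$ to $j$ and fixes everything else and $[i,j]$ interchanges $i$ and $j$. Then: 1. $\mathfrak A$ is atomic; 2. the atom structure of (the cylindric reduct of) $\mathfrak A$ is weakly neat; 3. this atom structure is not strongly neat; 4. the reduct of $\mathfrak A$ to the operations of $\mathsf{SC}_\alpha$ (Boolean operations, $c_i$, $s^i_j$) is not in $\mathsf{Nr}_\alpha\mathsf{SC}_{\alpha+1}$; 5. $w$ is not an element of $\mathfrak A$. -/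

import Mathlib

open Set

universe u v w

/-! # Cylindric algebras, substitution algebras, neat reducts, atom structures -/

/-- Cylindric algebras with index set `I` (for `I = Set.Iio α` these are the members of `CA_α`). -/
structure CylindricAlgebra (I : Type u) : Type (max u (w + 1)) where
  carrier : Type w
  [boolean : BooleanAlgebra carrier]
  /-- cylindrifications -/
  c : I → carrier → carrier
  /-- diagonal elements -/
  d : I → I → carrier
  c_bot : ∀ i, c i ⊥ = ⊥
  le_c : ∀ i x, x ≤ c i x
  c_inf_c : ∀ i x y, c i (x ⊓ c i y) = c i x ⊓ c i y
  c_comm : ∀ i j x, c i (c j x) = c j (c i x)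
  d_self : ∀ i, d i i = ⊤
  d_eq : ∀ i j k, k ≠ i → k ≠ j → d i j = c k (d i k ⊓ d k j)
  c_d_compl : ∀ i j x, i ≠ j → c i (d i j ⊓ x) ⊓ c i (d i j ⊓ xᶜ) = ⊥

attribute [instance] CylindricAlgebra.boolean

/-- Pinter's substitution algebras with index set `I` (for `I = Set.Iio α`: the class `SC_α`).
`s i j` is the replacement operation `s^i_j` (substitute `j` for `i`). -/
structure SubstitutionAlgebra (I : Type u) : Type (max u (w + 1)) where
  carrier : Type w
  [boolean : BooleanAlgebra carrier]
  /-- cylindrifications -/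
  c : I → carrier → carrier
  /-- replacements -/
  s : I → I → carrier → carrier
  c_bot : ∀ i, c i ⊥ = ⊥
  le_c : ∀ i x, x ≤ c i x
  c_inf_c : ∀ i x y, c i (x ⊓ c i y) = c i x ⊓ c i y
  c_comm : ∀ i j x, c i (c j x) = c j (c i x)
  s_self : ∀ i x, s i i x = x
  s_inf : ∀ i j x y, s i j (x ⊓ y) = s i j x ⊓ s i j y
  s_compl : ∀ i j x, s i j xᶜ = (s i j x)ᶜ
  s_c : ∀ i j x, s i j (c i x) = c i x
  c_s : ∀ i j x, i ≠ j → c i (s i j x) = s i j x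
  s_c_comm : ∀ i j k x, k ≠ i → k ≠ j → s i j (c k x) = c k (s i j x)
  c_s_swap : ∀ i j x, c i (s j i x) = c j (s i j x)
  s_s_comm : ∀ i j k l x, i ≠ j → i ≠ k → i ≠ l → j ≠ k → j ≠ l → k ≠ l →
    s j i (s l k x) = s l k (s j i x)
  s_s : ∀ i j l x, s l i (s j l x) = s l i (s j i x)

attribute [instance] SubstitutionAlgebra.boolean

/-- Isomorphism of cylindric algebras (an order isomorphism is a Boolean isomorphism). -/
def CylindricAlgebra.Isomorphic {I : Type u} (A B : CylindricAlgebra.{u, w} I) : Prop :=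
  ∃ f : A.carrier ≃o B.carrier,
    (∀ i x, f (A.c i x) = B.c i (f x)) ∧ ∀ i j, f (A.d i j) = B.d i j

/-- Isomorphism of substitution algebras. -/
def SubstitutionAlgebra.Isomorphic {I : Type u} (A B : SubstitutionAlgebra.{u, w} I) : Prop :=
  ∃ f : A.carrier ≃o B.carrier,
    (∀ i x, f (A.c i x) = B.c i (f x)) ∧ ∀ i j x, f (A.s i j x) = B.s i j (f x)

theorem compl_fixed {B : Type w} [BooleanAlgebra B] (c : B → B) (h0 : c ⊥ = ⊥)
    (h1 : ∀ x, x ≤ c x) (h2 : ∀ x y, c (x ⊓ c y) = c x ⊓ c y) {x : B} (hx : c x = x) :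
    c xᶜ = xᶜ := by
  refine le_antisymm ?_ (h1 _)
  have h := h2 xᶜ x
  rw [hx, compl_inf_eq_bot, h0] at h
  exact le_compl_iff_disjoint_right.2 (disjoint_iff.2 h.symm)

/-- The elements fixed by all `c k` with `P k` form a Boolean subalgebra. -/
def fixedSubalgebra {B : Type w} [BooleanAlgebra B] {K : Type u} (c : K → B → B)
    (h0 : ∀ k, c k ⊥ = ⊥) (h1 : ∀ k x, x ≤ c k x)
    (h2 : ∀ k x y, c k (x ⊓ c k y) = c k x ⊓ c k y) (P : K → Prop) : BooleanSubalgebra B where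
  carrier := {x | ∀ k, P k → c k x = x}
  bot_mem' := fun k _ => h0 k
  compl_mem' := fun hx k hk => compl_fixed (c k) (h0 k) (h1 k) (h2 k) (hx k hk)
  infClosed' := fun x hx y hy k hk => by
    have h := h2 k x y
    rw [hx k hk, hy k hk] at h
    exact h
  supClosed' := fun x hx y hy k hk => by
    have h := h2 k xᶜ yᶜ
    have hx' := compl_fixed (c k) (h0 k) (h1 k) (h2 k) (hx k hk)
    have hy' := compl_fixed (c k) (h0 k) (h1 k) (h2 k) (hy k hk)
    rw [hx', hy', ← compl_sup] at h
    simpa using compl_fixed (c k) (h0 k) (h1 k) (h2 k) h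

/-- The inclusion of the index set `α` into the index set `β`, for ordinals `α ≤ β`. -/
def dimIncl {α β : Ordinal.{u}} (h : α ≤ β) (i : Iio α) : Iio β := ⟨i.1, lt_of_lt_of_le i.2 h⟩

theorem dimIncl_injective {α β : Ordinal.{u}} (h : α ≤ β) : Function.Injective (dimIncl h) :=
  fun _ _ hij => Subtype.ext (congrArg (fun k => k.1) hij)

theorem ne_dimIncl {α β : Ordinal.{u}} (h : α ≤ β) {k : Iio β} (hk : α ≤ k.1) (i : Iio α) :
    k ≠ dimIncl h i := by
  rintro rfl
  exact absurd i.2 (not_lt.2 hk)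

/-- The (full) neat `α`-reduct `Nr_α B` of `B ∈ CA_β`: its elements are the `x` with `c_k x = x`
for all `α ≤ k < β`, its operations those of `B` with indices below `α`. -/
def CylindricAlgebra.neatReduct {α β : Ordinal.{u}} (h : α ≤ β)
    (B : CylindricAlgebra.{u + 1, w} (Iio β)) : CylindricAlgebra.{u + 1, w} (Iio α) where
  carrier := fixedSubalgebra B.c B.c_bot B.le_c B.c_inf_c (fun k => α ≤ k.1)
  c i x := ⟨B.c (dimIncl h i) x.1, fun k hk => by rw [B.c_comm, x.2 k hk]⟩
  d i j := ⟨B.d (dimIncl h i) (dimIncl h j), fun k hk => by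
    have hcc : ∀ x, B.c k (B.c k x) = B.c k x := fun x => by
      have := B.c_inf_c k ⊤ x
      rw [top_inf_eq] at this
      rw [this, top_le_iff.1 (B.le_c k ⊤), top_inf_eq]
    rw [B.d_eq _ _ k (ne_dimIncl h hk i) (ne_dimIncl h hk j), hcc]⟩
  c_bot i := Subtype.ext (B.c_bot _)
  le_c i x := B.le_c (dimIncl h i) x.1
  c_inf_c i x y := Subtype.ext (B.c_inf_c _ _ _)
  c_comm i j x := Subtype.ext (B.c_comm _ _ _)
  d_self i := Subtype.ext (B.d_self _)
  d_eq i j k hi hj := Subtype.ext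
    (B.d_eq _ _ _ ((dimIncl_injective h).ne hi) ((dimIncl_injective h).ne hj))
  c_d_compl i j x hij := Subtype.ext (B.c_d_compl _ _ _ ((dimIncl_injective h).ne hij))

/-- The (full) neat `α`-reduct `Nr_α B` of `B ∈ SC_β`. -/
def SubstitutionAlgebra.neatReduct {α β : Ordinal.{u}} (h : α ≤ β)
    (B : SubstitutionAlgebra.{u + 1, w} (Iio β)) : SubstitutionAlgebra.{u + 1, w} (Iio α) where
  carrier := fixedSubalgebra B.c B.c_bot B.le_c B.c_inf_c (fun k => α ≤ k.1)
  c i x := ⟨B.c (dimIncl h i) x.1, fun k hk => by rw [B.c_comm, x.2 k hk]⟩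
  s i j x := ⟨B.s (dimIncl h i) (dimIncl h j) x.1, fun k hk => by
    rw [← B.s_c_comm _ _ _ _ (ne_dimIncl h hk i) (ne_dimIncl h hk j), x.2 k hk]⟩
  c_bot i := Subtype.ext (B.c_bot _)
  le_c i x := B.le_c (dimIncl h i) x.1
  c_inf_c i x y := Subtype.ext (B.c_inf_c _ _ _)
  c_comm i j x := Subtype.ext (B.c_comm _ _ _)
  s_self i x := Subtype.ext (B.s_self _ _)
  s_inf i j x y := Subtype.ext (B.s_inf _ _ _ _)
  s_compl i j x := Subtype.ext (B.s_compl _ _ _)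
  s_c i j x := Subtype.ext (B.s_c _ _ _)
  c_s i j x hij := Subtype.ext (B.c_s _ _ _ ((dimIncl_injective h).ne hij))
  s_c_comm i j k x hi hj := Subtype.ext
    (B.s_c_comm _ _ _ _ ((dimIncl_injective h).ne hi) ((dimIncl_injective h).ne hj))
  c_s_swap i j x := Subtype.ext (B.c_s_swap _ _ _)
  s_s_comm i j k l x h1 h2 h3 h4 h5 h6 := Subtype.ext
    (B.s_s_comm _ _ _ _ _ ((dimIncl_injective h).ne h1) ((dimIncl_injective h).ne h2)
      ((dimIncl_injective h).ne h3) ((dimIncl_injective h).ne h4) ((dimIncl_injective h).ne h5)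
      ((dimIncl_injective h).ne h6))
  s_s i j l x := Subtype.ext (B.s_s _ _ _ _)

/-- `A ∈ Nr_α CA_β` (up to isomorphism). -/
def CylindricAlgebra.IsNeatReduct {α : Ordinal.{u}} (β : Ordinal.{u}) (h : α ≤ β)
    (A : CylindricAlgebra.{u + 1, w} (Iio α)) : Prop :=
  ∃ B : CylindricAlgebra.{u + 1, w} (Iio β), A.Isomorphic (B.neatReduct h)

/-- `A ∈ Nr_α SC_β` (up to isomorphism). -/
def SubstitutionAlgebra.IsNeatReduct {α : Ordinal.{u}} (β : Ordinal.{u}) (h : α ≤ β)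
    (A : SubstitutionAlgebra.{u + 1, w} (Iio α)) : Prop :=
  ∃ B : SubstitutionAlgebra.{u + 1, w} (Iio β), A.Isomorphic (B.neatReduct h)

/-- Relational structures of the type of cylindric atom structures: one binary relation for each
cylindrification and one unary relation for each diagonal element. -/
structure AtomStructure (I : Type u) : Type (max u (w + 1)) where
  carrier : Type w
  T : I → carrier → carrier → Prop
  E : I → I → carrier → Prop

/-- Isomorphism of atom structures. -/
def AtomStructure.Isomorphic {I : Type u} (S S' : AtomStructure.{u, w} I) : Prop :=
  ∃ f : S.carrier ≃ S'.carrier,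
    (∀ i a b, S.T i a b ↔ S'.T i (f a) (f b)) ∧ ∀ i j a, S.E i j a ↔ S'.E i j (f a)

/-- The atom structure `At A`: the atoms of `A`, with `T_i = {(a, b) : a ≤ c_i b}` and
`E_ij = {a : a ≤ d_ij}`. -/
def CylindricAlgebra.atomStructure {I : Type u} (A : CylindricAlgebra.{u, w} I) :
    AtomStructure.{u, w} I where
  carrier := {a : A.carrier // IsAtom a}
  T i a b := a.1 ≤ A.c i b.1
  E i j a := a.1 ≤ A.d i j

/-- `A` is based on the atom structure `S`: `A` is atomic and its atom structure is (isomorphic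
to) `S`. -/
def CylindricAlgebra.BasedOn {I : Type u} (A : CylindricAlgebra.{u, w} I)
    (S : AtomStructure.{u, w} I) : Prop :=
  IsAtomic A.carrier ∧ A.atomStructure.Isomorphic S

/-- `S` is weakly neat: some algebra based on `S` is in `Nr_α CA_{α+ω}`. -/
def AtomStructure.IsWeaklyNeat {α : Ordinal.{u}} (S : AtomStructure.{u + 1, w} (Iio α)) : Prop :=
  ∃ A : CylindricAlgebra.{u + 1, w} (Iio α),
    A.BasedOn S ∧ A.IsNeatReduct (α + Ordinal.omega0) le_self_add

/-- `S` is strongly neat: every algebra based on `S` is in `Nr_α CA_{α+ω}`. -/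
def AtomStructure.IsStronglyNeat {α : Ordinal.{u}} (S : AtomStructure.{u + 1, w} (Iio α)) : Prop :=
  ∀ A : CylindricAlgebra.{u + 1, w} (Iio α),
    A.BasedOn S → A.IsNeatReduct (α + Ordinal.omega0) le_self_add

/-! # Set algebras on the weak space of finitely supported sequences -/

namespace WeakSpace

variable {I : Type u} {F : Type v} [Zero F]

/-- Cylindrification in the weak space. -/
def cyl (i : I) (X : Set (I →₀ F)) : Set (I →₀ F) :=
  {s | ∃ t ∈ X, ∀ j, j ≠ i → s j = t j}

variable (F) in
/-- Diagonal sets. -/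
def diag (i j : I) : Set (I →₀ F) := {s | s i = s j}

/-- Replacement: `s ∈ repl i j X` iff `s ∘ [i|j] ∈ X`, where `[i|j]` maps `i` to `j` and fixes
everything else. -/
noncomputable def repl (i j : I) (X : Set (I →₀ F)) : Set (I →₀ F) :=
  {s | s.update i (s j) ∈ X}

open Classical in
/-- Transposition: `s ∈ transp i j X` iff `s ∘ [i,j] ∈ X`, where `[i,j]` interchanges
`i` and `j`. -/
noncomputable def transp (i j : I) (X : Set (I →₀ F)) : Set (I →₀ F) :=
  {s | s.equivMapDomain (Equiv.swap i j) ∈ X}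

/-- Membership in the subalgebra generated by `G` of the full quasi-polyadic equality set algebra
on the weak space (all sets of finitely supported sequences, with the Boolean set operations,
cylindrifications, replacements, transpositions and diagonals). -/
inductive Generated (G : Set (Set (I →₀ F))) : Set (I →₀ F) → Prop
  | basic (X) : X ∈ G → Generated G X
  | empty : Generated G ∅
  | compl (X) : Generated G X → Generated G Xᶜ
  | inter (X Y) : Generated G X → Generated G Y → Generated G (X ∩ Y)
  | cyl (i : I) (X) : Generated G X → Generated G (cyl i X)
  | diag (i j : I) : Generated G (diag F i j)
  | repl (i j : I) (X) : Generated G X → Generated G (repl i j X)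
  | transp (i j : I) (X) : Generated G X → Generated G (transp i j X)

/-- The Boolean algebra of sets underlying the generated algebra `Sg G`. -/
def sg (G : Set (Set (I →₀ F))) : BooleanSubalgebra (Set (I →₀ F)) where
  carrier := {X | Generated G X}
  bot_mem' := Generated.empty
  compl_mem' := fun hX => Generated.compl _ hX
  infClosed' := fun X hX Y hY => Generated.inter X Y hX hY
  supClosed' := fun X hX Y hY => by
    have h : X ⊔ Y = (Xᶜ ∩ Yᶜ)ᶜ := by
      rw [Set.compl_inter, compl_compl, compl_compl]; rfl
    rw [h]
    exact Generated.compl _ (Generated.inter _ _ (Generated.compl _ hX) (Generated.compl _ hY))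

theorem mem_cyl {i : I} {X : Set (I →₀ F)} {s : I →₀ F} :
    s ∈ cyl i X ↔ ∃ t ∈ X, ∀ j, j ≠ i → s j = t j := Iff.rfl

theorem cyl_empty (i : I) : cyl i (∅ : Set (I →₀ F)) = ∅ := by
  ext s; simp [cyl]

theorem subset_cyl (i : I) (X : Set (I →₀ F)) : X ⊆ cyl i X := fun s hs => ⟨s, hs, fun _ _ => rfl⟩

theorem cyl_inter_cyl (i : I) (X Y : Set (I →₀ F)) : cyl i (X ∩ cyl i Y) = cyl i X ∩ cyl i Y := by
  ext s
  constructor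
  · rintro ⟨t, ⟨ht, r, hr, htr⟩, hst⟩
    exact ⟨⟨t, ht, hst⟩, r, hr, fun j hj => (hst j hj).trans (htr j hj)⟩
  · rintro ⟨⟨t, ht, hst⟩, r, hr, hsr⟩
    exact ⟨t, ⟨ht, r, hr, fun j hj => (hst j hj).symm.trans (hsr j hj)⟩, hst⟩

theorem cyl_comm_subset (i j : I) (X : Set (I →₀ F)) : cyl i (cyl j X) ⊆ cyl j (cyl i X) := by
  classical
  rintro s ⟨t, ⟨r, hr, htr⟩, hst⟩
  refine ⟨r.update i (s i), ⟨r, hr, fun k hk => by simp [hk]⟩, fun k hk => ?_⟩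
  by_cases hki : k = i
  · subst hki; simp
  · simp [hki, hst k hki, htr k hk]

theorem cyl_comm (i j : I) (X : Set (I →₀ F)) : cyl i (cyl j X) = cyl j (cyl i X) :=
  Subset.antisymm (cyl_comm_subset i j X) (cyl_comm_subset j i X)

theorem diag_self (i : I) : diag F i i = univ := by
  ext s; simp [diag]

theorem diag_eq (i j k : I) (hi : k ≠ i) (hj : k ≠ j) :
    diag F i j = cyl k (diag F i k ∩ diag F k j) := by
  classical
  ext s
  constructor
  · intro hs
    have hs' : s i = s j := hs
    refine ⟨s.update k (s i), ⟨?_, ?_⟩, fun l hl => by simp [hl]⟩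
    · simp [diag, hi.symm]
    · simp [diag, hj.symm, hs']
  · rintro ⟨t, ⟨h1, h2⟩, hst⟩
    have h1' : t i = t k := h1
    have h2' : t k = t j := h2
    change s i = s j
    rw [hst i hi.symm, hst j hj.symm, h1', h2']

theorem cyl_diag_compl (i j : I) (X : Set (I →₀ F)) (hij : i ≠ j) :
    cyl i (diag F i j ∩ X) ∩ cyl i (diag F i j ∩ Xᶜ) = ∅ := by
  ext s
  simp only [mem_inter_iff, mem_empty_iff_false, iff_false, not_and]
  rintro ⟨t, ⟨ht, htX⟩, hst⟩ ⟨r, ⟨hr, hrX⟩, hsr⟩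
  have ht' : t i = t j := ht
  have hr' : r i = r j := hr
  apply hrX
  have : r = t := by
    ext k
    by_cases hk : k = i
    · rw [hk, ht', hr', ← hst j hij.symm, ← hsr j hij.symm]
    · rw [← hst k hk, ← hsr k hk]
  exact this ▸ htX

theorem mem_repl {i j : I} {X : Set (I →₀ F)} {s : I →₀ F} :
    s ∈ repl i j X ↔ s.update i (s j) ∈ X := Iff.rfl

theorem mem_cyl_iff_update {i : I} {X : Set (I →₀ F)} {s : I →₀ F} :
    s ∈ cyl i X ↔ ∃ a, s.update i a ∈ X := by
  classical
  constructor
  · rintro ⟨t, ht, hst⟩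
    refine ⟨t i, ?_⟩
    have : s.update i (t i) = t := by
      ext k
      by_cases hk : k = i
      · simp [hk]
      · simp [hk, hst k hk]
    rwa [this]
  · rintro ⟨a, ha⟩
    exact ⟨_, ha, fun j hj => by simp [hj]⟩

theorem repl_self (i : I) (X : Set (I →₀ F)) : repl i i X = X := by
  ext s; simp [repl]

theorem repl_cyl (i j : I) (X : Set (I →₀ F)) : repl i j (cyl i X) = cyl i X := by
  ext s; simp [mem_repl, mem_cyl_iff_update]

theorem cyl_repl (i j : I) (X : Set (I →₀ F)) (hij : i ≠ j) : cyl i (repl i j X) = repl i j X := by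
  classical
  ext s
  simp [mem_repl, mem_cyl_iff_update, Finsupp.update_apply, hij.symm]

theorem repl_cyl_comm (i j k : I) (X : Set (I →₀ F)) (hi : k ≠ i) (hj : k ≠ j) :
    repl i j (cyl k X) = cyl k (repl i j X) := by
  classical
  ext s
  simp only [mem_repl, mem_cyl_iff_update]
  refine exists_congr fun a => ?_
  rw [Finsupp.update_comm _ hi, Finsupp.update_apply, if_neg hj.symm]

theorem cyl_repl_swap_subset (i j : I) (X : Set (I →₀ F)) :
    cyl i (repl j i X) ⊆ cyl j (repl i j X) := by
  classical
  intro s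
  simp only [mem_repl, mem_cyl_iff_update]
  rintro ⟨a, ha⟩
  refine ⟨a, ?_⟩
  by_cases hij : i = j
  · subst hij; simpa using ha
  · rw [Finsupp.update_comm _ (Ne.symm hij)]
    simpa using ha

theorem cyl_repl_swap (i j : I) (X : Set (I →₀ F)) : cyl i (repl j i X) = cyl j (repl i j X) :=
  Subset.antisymm (cyl_repl_swap_subset i j X) (cyl_repl_swap_subset j i X)

theorem repl_comm (i j k l : I) (X : Set (I →₀ F)) (hil : i ≠ l) (hjk : j ≠ k)
    (hjl : j ≠ l) : repl j i (repl l k X) = repl l k (repl j i X) := by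
  classical
  ext s
  simp only [mem_repl]
  rw [Finsupp.update_comm _ hjl, Finsupp.update_apply, Finsupp.update_apply, if_neg hjk.symm,
    if_neg hil]

theorem repl_repl (i j l : I) (X : Set (I →₀ F)) :
    repl l i (repl j l X) = repl l i (repl j i X) := by
  classical
  ext s
  simp [mem_repl, Finsupp.update_apply]

/-- The cylindric reduct of the generated algebra `Sg G`. -/
def rdCA (G : Set (Set (I →₀ F))) : CylindricAlgebra.{u, max u v} I where
  carrier := sg G
  c i X := ⟨cyl i X.1, Generated.cyl i _ X.2⟩
  d i j := ⟨diag F i j, Generated.diag i j⟩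
  c_bot i := Subtype.ext (cyl_empty i)
  le_c i X := subset_cyl i X.1
  c_inf_c i X Y := Subtype.ext (cyl_inter_cyl i _ _)
  c_comm i j X := Subtype.ext (cyl_comm i j _)
  d_self i := Subtype.ext (diag_self i)
  d_eq i j k hi hj := Subtype.ext (diag_eq i j k hi hj)
  c_d_compl i j X hij := Subtype.ext (cyl_diag_compl i j _ hij)

/-- The `SC`-reduct of the generated algebra `Sg G`. -/
noncomputable def rdSC (G : Set (Set (I →₀ F))) : SubstitutionAlgebra.{u, max u v} I where
  carrier := sg G
  c i X := ⟨cyl i X.1, Generated.cyl i _ X.2⟩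
  s i j X := ⟨repl i j X.1, Generated.repl i j _ X.2⟩
  c_bot i := Subtype.ext (cyl_empty i)
  le_c i X := subset_cyl i X.1
  c_inf_c i X Y := Subtype.ext (cyl_inter_cyl i _ _)
  c_comm i j X := Subtype.ext (cyl_comm i j _)
  s_self i X := Subtype.ext (repl_self i _)
  s_inf i j X Y := rfl
  s_compl i j X := rfl
  s_c i j X := Subtype.ext (repl_cyl i j _)
  c_s i j X hij := Subtype.ext (cyl_repl i j _ hij)
  s_c_comm i j k X hi hj := Subtype.ext (repl_cyl_comm i j k _ hi hj)
  c_s_swap i j X := Subtype.ext (cyl_repl_swap i j _)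
  s_s_comm i j k l X _ _ hil hjk hjl _ := Subtype.ext (repl_comm i j k l _ hil hjk hjl)
  s_s i j l X := Subtype.ext (repl_repl i j l _)

end WeakSpace

/-! # The hyperplanes and the algebra -/

/-- The hyperplane `y = {s : s_0 + 1 = ∑_{i>0} s_i}` of the weak space of dimension `α > 1`. -/
noncomputable def planeY (α : Ordinal.{u}) (hα : 1 < α) (F : Type v) [Field F] : Set (Iio α →₀ F) :=
  {s | s ⟨0, zero_lt_one.trans hα⟩ + 1 = ∑ i ∈ s.support with 0 < i.1, s i}

/-- The hyperplane `w = {s : s_0 + 2 = s_1 + 2 ∑_{i>1} s_i}`. -/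
noncomputable def planeW (α : Ordinal.{u}) (hα : 1 < α) (F : Type v) [Field F] : Set (Iio α →₀ F) :=
  {s | s ⟨0, zero_lt_one.trans hα⟩ + 2 =
    s ⟨1, hα⟩ + 2 * ∑ i ∈ s.support with 1 < i.1, s i}

/-- The generators: `y` and the singletons `{s}` with `s ∈ y`. -/
noncomputable def generators (α : Ordinal.{u}) (hα : 1 < α) (F : Type v) [Field F] : Set (Set (Iio α →₀ F)) :=
  insert (planeY α hα F) {X | ∃ s ∈ planeY α hα F, X = {s}}

/-!
The algebra generated by `y` and its points contains every point `s` of the weak space: move `s`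
along two different coordinate axes into `y` and intersect the two cylinders. Hence it is atomic
with atoms the singletons, and its atom structure is that of the algebra of all subsets of the weak
space. As sequences have finite support, the latter algebra is the full neat reduct of the
corresponding algebra of any larger dimension (`WeakSpace.isNeatReduct_rdCA_univ`), so the atom
structure is weakly neat.

In an algebra of larger dimension a spare index `k` is available, and `c_k (s^1_k y · s^0_k y)`
says that some `z` satisfies `s[1:=z] ∈ y` and `s[0:=z] ∈ y`, which is the equation of `w`. If
the generated algebra were a neat reduct, this element would belong to it, and comparison with the
atoms, using only the axioms of substitution algebras, shows that it would be the set `w`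
(`WeakSpace.Generated.comp`, `planeW_eq_comp`). Cylindric algebras have substitution algebra
reducts (`CylindricAlgebra.toSubstitutionAlgebra`), so the same argument refutes strong neatness.

It remains to see that `w` is not generated. Call an affine subspace basic if it does not depend on
some coordinate or contains none of the points `2 eᵢ`, and call a set tame if it is a Boolean
combination of finitely many basic affine subspaces. All generators are tame, and tame sets are
closed under all the operations. For cylindrifications this is elimination of a variable
(`WeakSpace.IsTame.cyl`): since the field is infinite, whether a point of the line through `s`
satisfies given affine equations and inequations is decided by affine conditions not involving that
coordinate. The hyperplane `w` depends on all coordinates and contains `2 e₁`, so it lies in no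
proper basic affine subspace; as an affine space over an infinite field is not a finite union of
proper affine subspaces, finitely many basic subspaces cannot separate `w` from its complement
(`WeakSpace.not_isTame_hyperplane`).
-/

/-! ### Affine subspaces of the weak space -/

namespace WeakSpace

section Flat

variable {I : Type u} {F : Type v} [Field F]

theorem mem_transp [d : DecidableEq I] {i j : I} {X : Set (I →₀ F)} {s : I →₀ F} :
    s ∈ transp i j X ↔ s.equivMapDomain (Equiv.swap i j) ∈ X := by
  rw [Subsingleton.elim d fun a b => Classical.propDecidable (a = b)]
  rfl

/-- An affine subspace of the weak space, possibly empty, as a set. -/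
def IsFlat (X : Set (I →₀ F)) : Prop :=
  ∀ ⦃r⦄, r ∈ X → ∀ ⦃p⦄, p ∈ X → ∀ ⦃q⦄, q ∈ X → ∀ c : F, r + c • (p - q) ∈ X

theorem isFlat_univ : IsFlat (univ : Set (I →₀ F)) := fun _ _ _ _ _ _ _ => mem_univ _

theorem isFlat_singleton (s : I →₀ F) : IsFlat {s} := by
  rintro r rfl p rfl q rfl c
  simp

theorem IsFlat.sInter {S : Set (Set (I →₀ F))} (h : ∀ X ∈ S, IsFlat X) : IsFlat (⋂₀ S) :=
  fun _ hr _ hp _ hq c X hX => h X hX (hr X hX) (hp X hX) (hq X hX) c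

theorem isFlat_hyperplane (φ : (I →₀ F) →ₗ[F] F) (a : F) : IsFlat {s | φ s = a} := by
  intro r hr p hp q hq c
  simp only [mem_ofPred_eq] at *
  simp [hr, hp, hq]

theorem isFlat_diag (i j : I) : IsFlat (diag F i j) := by
  intro r hr p hp q hq c
  have hr' : r i = r j := hr
  have hp' : p i = p j := hp
  have hq' : q i = q j := hq
  simp [diag, hr', hp', hq']

theorem IsFlat.cyl {X : Set (I →₀ F)} (h : IsFlat X) (i : I) : IsFlat (cyl i X) := by
  rintro r ⟨r', hr, hrr⟩ p ⟨p', hp, hpp⟩ q ⟨q', hq, hqq⟩ c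
  exact ⟨_, h hr hp hq c, fun j hj => by simp [hrr j hj, hpp j hj, hqq j hj]⟩

theorem IsFlat.repl {X : Set (I →₀ F)} (h : IsFlat X) (i j : I) : IsFlat (repl i j X) := by
  classical
  intro r hr p hp q hq c
  rw [mem_repl] at *
  convert h hr hp hq c using 1
  ext k
  by_cases hk : k = i
  · subst hk; simp
  · simp [hk]

theorem IsFlat.transp {X : Set (I →₀ F)} (h : IsFlat X) (i j : I) : IsFlat (transp i j X) := by
  classical
  intro r hr p hp q hq c
  rw [mem_transp] at *
  convert h hr hp hq c using 1
  ext k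
  simp

/-- An affine subspace with two points on a line parallel to the `i`-th axis is a union of such
lines. -/
theorem IsFlat.cyl_eq_self {X : Set (I →₀ F)} (h : IsFlat X) {i : I} {s : I →₀ F} {a b : F}
    (ha : s.update i a ∈ X) (hb : s.update i b ∈ X) (hab : a ≠ b) : WeakSpace.cyl i X = X := by
  classical
  refine Subset.antisymm ?_ (subset_cyl i X)
  rintro t ⟨r, hr, htr⟩
  convert h hr ha hb ((t i - r i) / (a - b)) using 1
  ext k
  by_cases hk : k = i
  · subst hk
    simp [div_mul_cancel₀ _ (sub_ne_zero.2 hab)]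
  · simp [hk, htr k hk]

/-- Over an infinite field an affine subspace covered by finitely many affine subspaces is
contained in one of them. -/
theorem IsFlat.exists_subset_of_subset_sUnion [Infinite F] {W : Set (I →₀ F)} (hW : IsFlat W)
    (hne : W.Nonempty) {S : Set (Set (I →₀ F))} (hS : S.Finite) (hflat : ∀ X ∈ S, IsFlat X)
    (hcov : W ⊆ ⋃₀ S) : ∃ X ∈ S, W ⊆ X := by
  induction S, hS using Set.Finite.induction_on with
  | empty =>
    obtain ⟨s, hs⟩ := hne
    simpa using hcov hs
  | @insert B S _ hS ih =>
    by_cases hrest : W ⊆ ⋃₀ S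
    · obtain ⟨X, hX, hWX⟩ := ih (fun X hX => hflat X (mem_insert_of_mem _ hX)) hrest
      exact ⟨X, mem_insert_of_mem _ hX, hWX⟩
    refine ⟨B, mem_insert _ _, fun p hp => ?_⟩
    by_contra hpB
    obtain ⟨q, hq, hqS⟩ := not_subset.1 hrest
    have hqB : q ∈ B := by
      obtain ⟨X, rfl | hX, hqX⟩ := hcov hq
      · exact hqX
      · exact absurd ⟨X, hX, hqX⟩ hqS
    have hBflat := hflat B (mem_insert _ _)
    -- Apart from `q`, the line through `p` and `q` lies in the union of `S`.
    have hline : ∀ c : {c : F // c ≠ 0}, ∃ X : S, q + c.1 • (p - q) ∈ X.1 := by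
      rintro ⟨c, hc⟩
      obtain ⟨X, rfl | hX, hcX⟩ := hcov (hW hq hp hq c)
      · refine absurd ?_ hpB
        have := hBflat hqB hcX hqB c⁻¹
        rwa [add_sub_cancel_left, smul_smul, inv_mul_cancel₀ hc, one_smul,
          add_sub_cancel] at this
      · exact ⟨⟨X, hX⟩, hcX⟩
    choose g hg using hline
    have : Finite S := hS
    have : Infinite {c : F // c ≠ 0} := (Set.finite_singleton (0 : F)).infinite_compl.to_subtype
    obtain ⟨c, d, hcd, hgcd⟩ := Finite.exists_ne_map_eq_of_infinite g
    have hcd' : c.1 - d.1 ≠ 0 := sub_ne_zero.2 fun h => hcd (Subtype.ext h)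
    refine hqS ⟨(g c).1, (g c).2, ?_⟩
    have h1 := hg c
    have h2 := hg d
    rw [← hgcd] at h2
    have := hflat _ (mem_insert_of_mem _ (g c).2) h1 h1 h2 (-c.1 / (c.1 - d.1))
    convert this using 1
    rw [add_sub_add_left_eq_sub, ← sub_smul, smul_smul, div_mul_cancel₀ _ hcd', neg_smul,
      add_neg_cancel_right]

end Flat

theorem cyl_cyl {I : Type u} {F : Type v} [Zero F] (i : I) (X : Set (I →₀ F)) :
    cyl i (cyl i X) = cyl i X := by
  refine Subset.antisymm ?_ (subset_cyl _ _)
  rintro s ⟨t, ⟨r, hr, htr⟩, hst⟩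
  exact ⟨r, hr, fun j hj => (hst j hj).trans (htr j hj)⟩

theorem cyl_mono {I : Type u} {F : Type v} [Zero F] (i : I) {X Y : Set (I →₀ F)} (h : X ⊆ Y) :
    cyl i X ⊆ cyl i Y := fun _ ⟨t, ht, hst⟩ => ⟨t, h ht, hst⟩

theorem cyl_singleton_inter_cyl_singleton {I : Type u} {F : Type v} [Zero F] {i j : I}
    (hij : i ≠ j) (s : I →₀ F) : cyl i {s} ∩ cyl j {s} = {s} := by
  refine Subset.antisymm ?_ fun t ht => ⟨subset_cyl _ _ ht, subset_cyl _ _ ht⟩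
  rintro t ⟨⟨_, rfl, h1⟩, ⟨_, rfl, h2⟩⟩
  refine Finsupp.ext fun k => ?_
  by_cases hk : k = i
  · exact h2 k (hk.trans_ne hij)
  · exact h1 k hk

/-! ### Boolean combinations of affine subspaces -/

section Tame

variable {I : Type u} {F : Type v} [Field F]

/-- The affine subspaces of which the elements of the generated algebra are built: those that do
not depend on some coordinate, and those that avoid all the points `2 eᵢ`. The second kind, which
is invariant under transpositions, comprises the images of `planeY` under permutations of the
coordinates, but not `planeW`. -/
def IsBasic (X : Set (I →₀ F)) : Prop :=
  IsFlat X ∧ ((∃ i, cyl i X = X) ∨ ∀ i, Finsupp.single i 2 ∉ X)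

/-- A set is tame if membership in it depends only on membership in finitely many basic affine
subspaces, that is, if it is a Boolean combination of basic affine subspaces. -/
def IsTame (X : Set (I →₀ F)) : Prop :=
  ∃ S : Set (Set (I →₀ F)), S.Finite ∧ (∀ Y ∈ S, IsBasic Y) ∧
    ∀ s t, (∀ Y ∈ S, s ∈ Y ↔ t ∈ Y) → s ∈ X → t ∈ X

theorem IsFlat.isBasic_cyl {X : Set (I →₀ F)} (h : IsFlat X) (i : I) :
    IsBasic (WeakSpace.cyl i X) :=
  ⟨h.cyl i, Or.inl ⟨i, cyl_cyl i X⟩⟩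

theorem IsBasic.isTame {X : Set (I →₀ F)} (h : IsBasic X) : IsTame X :=
  ⟨{X}, finite_singleton X, by rintro _ rfl; exact h, fun _ _ hst => (hst X rfl).1⟩

theorem isTame_empty : IsTame (∅ : Set (I →₀ F)) :=
  ⟨∅, finite_empty, by simp, fun _ _ _ h => h⟩

theorem IsTame.compl {X : Set (I →₀ F)} (h : IsTame X) : IsTame Xᶜ := by
  obtain ⟨S, hS, hb, h⟩ := h
  exact ⟨S, hS, hb, fun s t hst hs ht => hs (h t s (fun Y hY => (hst Y hY).symm) ht)⟩

theorem IsTame.inter {X Y : Set (I →₀ F)} (hX : IsTame X) (hY : IsTame Y) : IsTame (X ∩ Y) := by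
  obtain ⟨S, hS, hSb, hX⟩ := hX
  obtain ⟨T, hT, hTb, hY⟩ := hY
  refine ⟨S ∪ T, hS.union hT, fun Z hZ => hZ.elim (hSb Z) (hTb Z), fun s t hst hs => ⟨?_, ?_⟩⟩
  · exact hX s t (fun Z hZ => hst Z (Or.inl hZ)) hs.1
  · exact hY s t (fun Z hZ => hst Z (Or.inr hZ)) hs.2

theorem isTame_singleton {i j : I} (hij : i ≠ j) (s : I →₀ F) : IsTame {s} := by
  rw [← cyl_singleton_inter_cyl_singleton hij s]
  exact (IsFlat.isBasic_cyl (isFlat_singleton s) i).isTame.inter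
    (IsFlat.isBasic_cyl (isFlat_singleton s) j).isTame

theorem isTame_diag [CharZero F] (i j : I) : IsTame (diag F i j) := by
  classical
  by_cases hij : i = j
  · subst hij
    rw [diag_self, ← compl_empty]
    exact isTame_empty.compl
  refine IsBasic.isTame ⟨isFlat_diag i j, ?_⟩
  by_cases h : ∃ k, k ≠ i ∧ k ≠ j
  · obtain ⟨k, hki, hkj⟩ := h
    left
    exact ⟨k, by rw [diag_eq i j k hki hkj, cyl_cyl]⟩
  · right
    intro k hk
    have hk' : Finsupp.single k (2 : F) i = Finsupp.single k (2 : F) j := hk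
    rw [Finsupp.single_apply, Finsupp.single_apply] at hk'
    rcases eq_or_ne k i with rfl | hki
    · simp [hij] at hk'
    · have : k = j := by
        by_contra hkj
        exact h ⟨k, hki, hkj⟩
      subst this
      simp [hki] at hk'

theorem IsTame.repl {X : Set (I →₀ F)} (h : IsTame X) (i j : I) : IsTame (repl i j X) := by
  by_cases hij : i = j
  · subst hij
    rwa [repl_self]
  obtain ⟨S, hS, hb, h⟩ := h
  refine ⟨(fun Y => WeakSpace.repl i j Y) '' S, hS.image _, ?_, fun s t hst hs => ?_⟩
  · rintro _ ⟨Y, hY, rfl⟩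
    exact ⟨(hb Y hY).1.repl i j, Or.inl ⟨i, cyl_repl i j Y hij⟩⟩
  · exact h _ _ (fun Y hY => hst _ (mem_image_of_mem _ hY)) hs

theorem IsBasic.transp {X : Set (I →₀ F)} (h : IsBasic X) (i j : I) : IsBasic (transp i j X) := by
  classical
  refine ⟨h.1.transp i j, h.2.imp ?_ fun h k hk => ?_⟩
  · rintro ⟨k, hk⟩
    refine ⟨Equiv.swap i j k, Subset.antisymm ?_ (subset_cyl _ _)⟩
    rintro s ⟨t, ht, hst⟩
    rw [mem_transp] at ht ⊢
    rw [← hk]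
    refine ⟨_, ht, fun l hl => ?_⟩
    simp only [Finsupp.equivMapDomain_apply, Equiv.symm_swap]
    convert hst (Equiv.swap i j l) fun h => hl ((Equiv.swap i j).injective h)
  · refine h (Equiv.swap i j k) ?_
    rwa [mem_transp, Finsupp.equivMapDomain_single] at hk

theorem IsTame.transp {X : Set (I →₀ F)} (h : IsTame X) (i j : I) : IsTame (transp i j X) := by
  obtain ⟨S, hS, hb, h⟩ := h
  refine ⟨(fun Y => WeakSpace.transp i j Y) '' S, hS.image _, ?_, fun s t hst hs => ?_⟩
  · rintro _ ⟨Y, hY, rfl⟩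
    exact (hb Y hY).transp i j
  · exact h _ _ (fun Y hY => hst _ (mem_image_of_mem _ hY)) hs

/-- Elimination of a coordinate: if membership in `X` depends on the family `S` of affine
subspaces, then membership in `cyl i X` depends on the cylinders over the intersections of
subfamilies of `S`. -/
theorem IsTame.cyl [Infinite F] {X : Set (I →₀ F)} (h : IsTame X) (i : I) : IsTame (cyl i X) := by
  obtain ⟨S, hS, hb, h⟩ := h
  refine ⟨(fun T => WeakSpace.cyl i (⋂₀ T)) '' 𝒫 S, hS.finite_subsets.image _, ?_,
    fun s t hst hs => ?_⟩
  · rintro _ ⟨T, hT, rfl⟩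
    exact IsFlat.isBasic_cyl (IsFlat.sInter fun Y hY => (hb Y (hT hY)).1) i
  have key : ∀ T ⊆ S, s ∈ WeakSpace.cyl i (⋂₀ T) ↔ t ∈ WeakSpace.cyl i (⋂₀ T) :=
    fun T hT => hst _ (mem_image_of_mem _ hT)
  rw [mem_cyl_iff_update] at hs
  obtain ⟨a, ha⟩ := hs
  -- `T` is the set of members of `S` that contain the witness for `s`; a witness for `t` has to
  -- lie in these and in no other members of `S`.
  let T : Set (Set (I →₀ F)) := {Y ∈ S | s.update i a ∈ Y}
  have hTS : T ⊆ S := fun Y hY => hY.1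
  have hTflat : IsFlat (⋂₀ T) := IsFlat.sInter fun Y hY => (hb Y hY.1).1
  have haT : s.update i a ∈ ⋂₀ T := fun Y hY => hY.2
  obtain ⟨b, hbT⟩ := mem_cyl_iff_update.1 ((key T hTS).1 (mem_cyl_iff_update.2 ⟨a, haT⟩))
  suffices ∃ c, t.update i c ∈ ⋂₀ T ∧ ∀ Y ∈ S, t.update i c ∈ Y → s.update i a ∈ Y by
    obtain ⟨c, hc, hc'⟩ := this
    exact mem_cyl_iff_update.2
      ⟨c, h _ _ (fun Y hY => ⟨fun hY' => hc Y ⟨hY, hY'⟩, hc' Y hY⟩) ha⟩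
  by_cases hcyl : WeakSpace.cyl i (⋂₀ T) = ⋂₀ T
  · -- The whole line through `t` lies in the intersection of `T`, and each of the other members
    -- of `S` contains at most one point of it.
    have hsub : ∀ Y ∈ S, s.update i a ∉ Y → {c | t.update i c ∈ Y}.Subsingleton := by
      intro Y hY haY c hc d hd
      by_contra hcd
      have hYcyl := (hb Y hY).1.cyl_eq_self hc hd hcd
      have := key {Y} (singleton_subset_iff.2 hY)
      rw [sInter_singleton] at this
      have hsY := this.2 (mem_cyl_iff_update.2 ⟨c, hc⟩)
      have hsa : s.update i a ∈ WeakSpace.cyl i Y := by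
        rw [← cyl_cyl]
        exact ⟨s, hsY, fun j hj => by classical simp [hj]⟩
      exact haY (hYcyl ▸ hsa)
    have hfin : (⋃ Y ∈ {Y ∈ S | s.update i a ∉ Y}, {c | t.update i c ∈ Y}).Finite :=
      (hS.subset (sep_subset _ _)).biUnion fun Y hY => (hsub Y hY.1 hY.2).finite
    obtain ⟨c, hc⟩ := hfin.infinite_compl.nonempty
    refine ⟨c, ?_, fun Y hY hcY => ?_⟩
    · rw [← hcyl]
      exact ⟨_, hbT, fun j hj => by classical simp [hj]⟩
    · by_contra haY
      exact hc (mem_biUnion (show Y ∈ {Y ∈ S | s.update i a ∉ Y} from ⟨hY, haY⟩) hcY)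
  · -- Each line parallel to the axis meets the intersection of `T` in at most one point.
    refine ⟨b, hbT, fun Y hY hbY => ?_⟩
    have := (key (insert Y T) (insert_subset hY hTS)).2
    rw [sInter_insert] at this
    obtain ⟨a', haY, haT'⟩ := mem_cyl_iff_update.1 (this (mem_cyl_iff_update.2 ⟨b, hbY, hbT⟩))
    have : a' = a := by
      by_contra hne
      exact hcyl (hTflat.cyl_eq_self haT' haT hne)
    exact this ▸ haY

theorem Generated.isTame [CharZero F] {G : Set (Set (I →₀ F))} (hG : ∀ X ∈ G, IsTame X)
    {X : Set (I →₀ F)} (hX : Generated G X) : IsTame X := by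
  induction hX with
  | basic X hX => exact hG X hX
  | empty => exact isTame_empty
  | compl X _ ih => exact ih.compl
  | inter X Y _ _ ihX ihY => exact ihX.inter ihY
  | cyl i X _ ih => exact ih.cyl i
  | diag i j => exact isTame_diag i j
  | repl i j X _ ih => exact ih.repl i j
  | transp i j X _ ih => exact ih.transp i j

theorem cyl_hyperplane (φ : (I →₀ F) →ₗ[F] F) (a : F) {i : I} (hi : φ (Finsupp.single i 1) ≠ 0) :
    cyl i {s | φ s = a} = univ := by
  classical
  refine eq_univ_of_forall fun s => ⟨s + Finsupp.single i ((a - φ s) / φ (Finsupp.single i 1)),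
    ?_, fun j hj => by simp [hj.symm]⟩
  have : Finsupp.single i ((a - φ s) / φ (Finsupp.single i 1)) =
      ((a - φ s) / φ (Finsupp.single i 1)) • Finsupp.single i (1 : F) := by simp
  simp only [mem_ofPred_eq]
  rw [this, map_add, map_smul, smul_eq_mul, div_mul_cancel₀ _ hi, add_sub_cancel]

/-- A hyperplane that depends on all coordinates and passes through one of the points `2 eᵢ` is
not tame: no proper basic affine subspace contains it, so for finitely many basic affine
subspaces a generic point of the hyperplane and a generic point of the whole space lie in the same
ones, namely in those equal to the whole space. -/
theorem not_isTame_hyperplane [Infinite F] (φ : (I →₀ F) →ₗ[F] F) (a : F)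
    (hφ : ∀ i, φ (Finsupp.single i 1) ≠ 0) {i : I} (hi : φ (Finsupp.single i 2) = a) :
    ¬ IsTame {s | φ s = a} := by
  rintro ⟨S, hS, hb, h⟩
  have hφflat := isFlat_hyperplane φ a
  have hproper : ∀ Y ∈ S, {s | φ s = a} ⊆ Y → Y = univ := by
    intro Y hY hsub
    rcases (hb Y hY).2 with ⟨j, hj⟩ | hY'
    · rw [← hj]
      exact univ_subset_iff.1 ((cyl_hyperplane φ a (hφ j)).ge.trans (cyl_mono j hsub))
    · exact absurd (hsub hi) (hY' i)
  have hfin : {Y ∈ S | Y ≠ univ}.Finite := hS.subset (sep_subset _ _)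
  have h1 : ∃ s, φ s = a ∧ s ∉ ⋃₀ {Y ∈ S | Y ≠ univ} := by
    by_contra! hcon
    obtain ⟨Y, hY, hsub⟩ := hφflat.exists_subset_of_subset_sUnion ⟨_, hi⟩ hfin
      (fun Y hY => (hb Y hY.1).1) hcon
    exact hY.2 (hproper Y hY.1 hsub)
  have h2 : ∃ t, t ∉ ⋃₀ insert {s | φ s = a} {Y ∈ S | Y ≠ univ} := by
    by_contra! hcon
    obtain ⟨Y, hY, hsub⟩ := isFlat_univ.exists_subset_of_subset_sUnion ⟨0, mem_univ _⟩
      (hfin.insert {s | φ s = a})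
      (by rintro Y (rfl | hY); exacts [hφflat, (hb Y hY.1).1]) fun t _ => hcon t
    rcases hY with rfl | hY
    · have h0 : φ 0 = a := hsub (mem_univ 0)
      have h1 : φ (Finsupp.single i 1) = a := hsub (mem_univ (Finsupp.single i 1))
      exact hφ i (by rw [h1, ← h0, map_zero])
    · exact hY.2 (univ_subset_iff.1 hsub)
  obtain ⟨s, hsa, hs⟩ := h1
  obtain ⟨t, ht⟩ := h2
  refine ht ⟨_, mem_insert _ _, h s t (fun Y hY => ?_) hsa⟩
  by_cases hYu : Y = univ
  · simp [hYu]
  · exact iff_of_false (fun h => hs ⟨Y, ⟨hY, hYu⟩, h⟩)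
      fun h => ht ⟨Y, mem_insert_of_mem _ ⟨hY, hYu⟩, h⟩

end Tame

end WeakSpace

/-! ### Composition in substitution algebras -/

namespace SubstitutionAlgebra

variable {K : Type u} (B : SubstitutionAlgebra.{u, w} K)

theorem c_top (i : K) : B.c i ⊤ = ⊤ := top_le_iff.1 (B.le_c i ⊤)

theorem c_c (i : K) (x : B.carrier) : B.c i (B.c i x) = B.c i x := by
  have := B.c_inf_c i ⊤ x
  rwa [top_inf_eq, c_top, top_inf_eq] at this

theorem s_mono (i j : K) {x y : B.carrier} (h : x ≤ y) : B.s i j x ≤ B.s i j y := by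
  rw [← inf_eq_left, ← B.s_inf, inf_eq_left.2 h]

theorem s_bot (i j : K) : B.s i j ⊥ = ⊥ := by
  have := B.s_inf i j ⊥ ⊥ᶜ
  rw [B.s_compl, inf_compl_eq_bot, inf_compl_eq_bot] at this
  exact this

/-- The composition `c_k (s^i_k x · s^o_k x)` of `x` with itself, in which the spare index `k`
carries the intermediate value. -/
def comp (o i k : K) (x : B.carrier) : B.carrier := B.c k (B.s i k x ⊓ B.s o k x)

variable {B} {o i k : K}

/-- If an element does not depend on `i`, its argument `o` can be moved to `k` by way of `i`. -/
theorem s_s_c (hoi : o ≠ i) (hik : i ≠ k) (x : B.carrier) :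
    B.s i k (B.s o i (B.c i x)) = B.s o k (B.c i x) := by
  rw [B.s_s, B.s_c_comm o k i x hoi.symm hik, B.s_c]

/-- If `p` is `k`-closed, only the points of `x` in the cylinders over `p` matter for the meet of
`p` with the composition of `x`. -/
theorem inf_comp_eq_bot (hoi : o ≠ i) (hik : i ≠ k) {p x : B.carrier}
    (hp : B.c k p = p)
    (h : B.c o (x ⊓ B.c i p) ⊓ B.s o i (B.c i (x ⊓ B.c o p)) = ⊥) :
    p ⊓ B.comp o i k x = ⊥ := by
  have h1 : ∀ j, B.s j k x ⊓ p ≤ B.s j k (x ⊓ B.c j p) := fun j => by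
    rw [B.s_inf, B.s_c]
    exact inf_le_inf_left _ (B.le_c j p)
  have h2 : B.s i k x ⊓ B.s o k x ⊓ p ≤ ⊥ := by
    calc B.s i k x ⊓ B.s o k x ⊓ p = B.s i k x ⊓ p ⊓ (B.s o k x ⊓ p) :=
          inf_inf_distrib_right _ _ _
      _ ≤ B.s i k (B.c o (x ⊓ B.c i p)) ⊓ B.s o k (B.c i (x ⊓ B.c o p)) :=
          inf_le_inf ((h1 i).trans (B.s_mono _ _ (B.le_c _ _)))
            ((h1 o).trans (B.s_mono _ _ (B.le_c _ _)))
      _ = ⊥ := by rw [← s_s_c hoi hik, ← B.s_inf, h, B.s_bot]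
  have h3 := B.c_inf_c k (B.s i k x ⊓ B.s o k x) p
  rw [hp, le_bot_iff.1 h2, B.c_bot] at h3
  rw [inf_comm]
  exact h3.symm

/-- The meet of `p` with the composition of `x` is not zero if `x` contains elements `a` and `b`
in the cylinders over `p` such that the `i`-th value of `a` is the `o`-th value of `b`. -/
theorem inf_comp_ne_bot (hoi : o ≠ i) (hik : i ≠ k) {p x a b : B.carrier} (hak : B.c k a = a)
    (ha : a ≤ x) (hb : b ≤ x) (hp : B.c o p ⊓ B.c i p ≤ p) (hbp : b ≤ B.c o p)
    (hap : a ≤ B.c i p) (hab : a ≤ B.s o i (B.c i b)) (ha0 : a ≠ ⊥) :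
    p ⊓ B.comp o i k x ≠ ⊥ := by
  have hle : B.s i k a ⊓ B.s o k b ≤ p ⊓ B.comp o i k x := by
    refine le_inf (le_trans ?_ hp) ?_
    · rw [inf_comm]
      refine inf_le_inf ?_ ?_
      · exact (B.s_mono o k hbp).trans (B.s_c o k p).le
      · exact (B.s_mono i k hap).trans (B.s_c i k p).le
    · exact (inf_le_inf (B.s_mono i k ha) (B.s_mono o k hb)).trans (B.le_c k _)
  intro h
  rw [h, le_bot_iff] at hle
  -- Closing `s^i_k a · s^o_k b` under `c_i` gives `s^i_k a`; closing that under `c_k` gives `c_i a`,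
  -- so `a` would vanish.
  have h1 := B.c_inf_c i (B.s o k b) (B.s i k a)
  rw [B.c_s i k a hik, inf_comm (B.s o k b), hle, B.c_bot, ← B.s_c_comm o k i b hoi.symm hik,
    ← s_s_c hoi hik, ← B.s_inf, inf_eq_right.2 hab] at h1
  have h2 := B.c_s_swap k i a
  rw [← h1, B.c_bot] at h2
  have h3 : B.s k i a = a := by rw [← hak, B.s_c]
  rw [h3] at h2
  exact ha0 (le_bot_iff.1 ((B.le_c i a).trans h2.ge))

theorem c_comp {m : K} (hmk : m ≠ k) (hmo : m ≠ o) (hmi : m ≠ i) {x : B.carrier}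
    (hx : B.c m x = x) : B.c m (B.comp o i k x) = B.comp o i k x := by
  have h1 : B.c m (B.s i k x ⊓ B.s o k x) = B.s i k x ⊓ B.s o k x := by
    have h := B.c_inf_c m (B.s i k x) (B.s o k x)
    rw [← B.s_c_comm i k m x hmi hmk, ← B.s_c_comm o k m x hmo hmk, hx] at h
    exact h
  rw [comp, B.c_comm, h1]

end SubstitutionAlgebra

/-! ### Neat reducts are closed under composition -/

namespace WeakSpace

/-- If an algebra containing all points is a neat reduct of an algebra of larger dimension, it is
closed under composition: the composition formed with a spare index in the larger algebra is the
composition of sets, because the points determine it. -/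
theorem Generated.comp {α β : Ordinal.{u}} {F : Type v} [Zero F] {G : Set (Set (Iio α →₀ F))}
    (hG : ∀ s, Generated G {s}) (hαβ : α < β) (hN : (rdSC G).IsNeatReduct β hαβ.le)
    {o i : Iio α} (hoi : o ≠ i) {X : Set (Iio α →₀ F)} (hX : Generated G X) :
    Generated G {s | ∃ z, s.update i z ∈ X ∧ s.update o z ∈ X} := by
  classical
  obtain ⟨B, f, hc, hs⟩ := hN
  let e : Iio α → Iio β := dimIncl hαβ.le
  let k : Iio β := ⟨α, hαβ⟩
  have hek : ∀ j, e j ≠ k := fun j => (ne_dimIncl hαβ.le (le_refl α) j).symm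
  have he : e o ≠ e i := (dimIncl_injective hαβ.le).ne hoi
  -- `g` is the embedding of the algebra into `B`.
  let g : (rdSC G).carrier → B.carrier := fun Y => (f Y).1
  have gmem : ∀ Y (m : Iio β), α ≤ m.1 → B.c m (g Y) = g Y := fun Y => (f Y).2
  have ginf : ∀ Y Z, g (Y ⊓ Z) = g Y ⊓ g Z := fun Y Z => congrArg Subtype.val (f.map_inf Y Z)
  have gbot : g ⊥ = ⊥ := congrArg Subtype.val f.map_bot
  have ginj : ∀ Y Z, g Y = g Z → Y = Z := fun Y Z h => f.injective (Subtype.ext h)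
  have gc : ∀ j Y, g ((rdSC G).c j Y) = B.c (e j) (g Y) := fun j Y =>
    congrArg Subtype.val (hc j Y)
  have gs : ∀ j l Y, g ((rdSC G).s j l Y) = B.s (e j) (e l) (g Y) := fun j l Y =>
    congrArg Subtype.val (hs j l Y)
  have gle : ∀ Y Z : (rdSC G).carrier, Y ≤ Z → g Y ≤ g Z := fun Y Z h => f.monotone h
  let x : (rdSC G).carrier := ⟨X, hX⟩
  let pt : (Iio α →₀ F) → (rdSC G).carrier := fun s => ⟨{s}, hG s⟩
  have hcomp : ∀ m : Iio β, α ≤ m.1 →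
      B.c m (B.comp (e o) (e i) k (g x)) = B.comp (e o) (e i) k (g x) := by
    intro m hm
    by_cases hmk : m = k
    · rw [hmk, SubstitutionAlgebra.comp, B.c_c]
    · exact SubstitutionAlgebra.c_comp hmk (ne_dimIncl hαβ.le hm o) (ne_dimIncl hαβ.le hm i)
        (gmem x m hm)
  let W : (rdSC G).carrier := f.symm ⟨_, hcomp⟩
  have gW : g W = B.comp (e o) (e i) k (g x) := congrArg Subtype.val (f.apply_symm_apply _)
  suffices hW : W.1 = {s | ∃ z, s.update i z ∈ X ∧ s.update o z ∈ X} from hW ▸ W.2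
  ext s
  constructor
  · intro hsW
    by_contra hcon
    -- The set `(rdSC G).c o (x ⊓ c i {s})` fixes the `i`-th value to some `z` with
    -- `s.update i z ∈ X`, the other one fixes it to some `z` with `s.update o z ∈ X`.
    have h1 : (rdSC G).c o (x ⊓ (rdSC G).c i (pt s)) ⊓
        (rdSC G).s o i ((rdSC G).c i (x ⊓ (rdSC G).c o (pt s))) = ⊥ := by
      refine Subtype.ext (Set.eq_empty_of_forall_notMem ?_)
      rintro t ⟨⟨t', ⟨ht'X, _, rfl, ht's⟩, htt'⟩, ⟨r, ⟨hrX, _, rfl, hrs⟩, htr⟩⟩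
      refine hcon ⟨t i, ?_, ?_⟩
      · convert ht'X using 1
        ext j
        by_cases hj : j = i
        · subst hj; simp [htt' j hoi.symm]
        · simp [hj, ht's j hj]
      · convert hrX using 1
        ext j
        by_cases hj : j = o
        · subst hj; simpa using htr j hoi
        · simp [hj, hrs j hj]
    have h2 := congrArg g h1
    rw [ginf, gc, gs, gc, ginf, ginf, gc, gc, gbot] at h2
    have h3 := SubstitutionAlgebra.inf_comp_eq_bot he (hek i) (gmem (pt s) k le_rfl) h2
    rw [← gW, ← ginf, ← gbot] at h3
    have h4 : s ∈ (pt s ⊓ W).1 := ⟨rfl, hsW⟩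
    rw [ginj _ _ h3] at h4
    exact h4
  · rintro ⟨z, hzi, hzo⟩
    let a := pt (s.update i z)
    let b := pt (s.update o z)
    have ha : g a ≤ g x := gle _ _ (show ({s.update i z} : Set _) ⊆ X by simpa using hzi)
    have hb : g b ≤ g x := gle _ _ (show ({s.update o z} : Set _) ⊆ X by simpa using hzo)
    have hp : B.c (e o) (g (pt s)) ⊓ B.c (e i) (g (pt s)) ≤ g (pt s) := by
      rw [← gc, ← gc, ← ginf]
      exact gle _ _ (cyl_singleton_inter_cyl_singleton hoi s).le
    have hup : ∀ j, pt (s.update j z) ≤ (rdSC G).c j (pt s) := by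
      rintro j t rfl
      exact ⟨s, rfl, fun l hl => by simp [hl]⟩
    have hbp : g b ≤ B.c (e o) (g (pt s)) := by
      rw [← gc]
      exact gle _ _ (hup o)
    have hap : g a ≤ B.c (e i) (g (pt s)) := by
      rw [← gc]
      exact gle _ _ (hup i)
    have hab : g a ≤ B.s (e o) (e i) (B.c (e i) (g b)) := by
      rw [← gc, ← gs]
      refine gle _ _ ?_
      rintro t rfl
      refine ⟨s.update o z, rfl, fun l hl => ?_⟩
      by_cases hlo : l = o
      · simp [hlo]
      · simp [hlo, hl]
    have ha0 : g a ≠ ⊥ := by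
      rw [← gbot]
      intro h
      have h1 : s.update i z ∈ a.1 := rfl
      rw [ginj _ _ h] at h1
      exact h1
    have h := SubstitutionAlgebra.inf_comp_ne_bot he (hek i) (gmem a k le_rfl) ha hb hp hbp hap
      hab ha0
    by_contra hsW
    apply h
    rw [← gW, ← ginf, ← gbot]
    refine congrArg g (Subtype.ext (Set.eq_empty_of_forall_notMem ?_))
    rintro t ⟨rfl, ht⟩
    exact hsW ht

end WeakSpace

/-! ### Substitution algebra reducts of cylindric algebras -/

namespace CylindricAlgebra

variable {K : Type u} (B : CylindricAlgebra.{u, w} K)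

theorem c_top (i : K) : B.c i ⊤ = ⊤ := top_le_iff.1 (B.le_c i ⊤)

theorem c_c (i : K) (x : B.carrier) : B.c i (B.c i x) = B.c i x := by
  have := B.c_inf_c i ⊤ x
  rwa [top_inf_eq, c_top, top_inf_eq] at this

theorem c_mono (i : K) {x y : B.carrier} (h : x ≤ y) : B.c i x ≤ B.c i y := by
  have := B.c_inf_c i x y
  rw [inf_eq_left.2 (h.trans (B.le_c i y))] at this
  exact inf_eq_left.1 this.symm

theorem c_inf_of_fixed {i : K} {y : B.carrier} (hy : B.c i y = y) (x : B.carrier) :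
    B.c i (y ⊓ x) = y ⊓ B.c i x := by
  have := B.c_inf_c i x y
  rwa [hy, inf_comm, inf_comm (B.c i x)] at this

theorem c_compl_c (i : K) (x : B.carrier) : B.c i (B.c i x)ᶜ = (B.c i x)ᶜ :=
  compl_fixed (B.c i) (B.c_bot i) (B.le_c i) (B.c_inf_c i) (B.c_c i x)

theorem c_sup (i : K) (x y : B.carrier) : B.c i (x ⊔ y) = B.c i x ⊔ B.c i y := by
  refine le_antisymm ?_ (sup_le (B.c_mono i le_sup_left) (B.c_mono i le_sup_right))
  have hfix : B.c i (B.c i x ⊔ B.c i y) = B.c i x ⊔ B.c i y := by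
    have h := compl_fixed (B.c i) (B.c_bot i) (B.le_c i) (B.c_inf_c i)
      (x := (B.c i x)ᶜ ⊓ (B.c i y)ᶜ)
      (by rw [B.c_inf_of_fixed (B.c_compl_c i x), c_compl_c])
    simpa using h
  exact (B.c_mono i (sup_le_sup (B.le_c i x) (B.le_c i y))).trans hfix.le

theorem c_d {i j k : K} (hi : k ≠ i) (hj : k ≠ j) : B.c k (B.d i j) = B.d i j := by
  rw [B.d_eq i j k hi hj, c_c]

theorem d_le_d_symm (i j : K) : B.d i j ≤ B.d j i := by
  rcases eq_or_ne i j with rfl | hij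
  · exact le_rfl
  -- The part of `d i j` outside `d j i` lies in `c i (d i j ⊓ (d j i)ᶜ)`, while
  -- `c i (d i j ⊓ d j i) = d j j = ⊤`.
  have h1 := B.c_d_compl i j (B.d j i) hij
  have h2 := B.d_eq j j i hij hij
  rw [B.d_self, inf_comm] at h2
  rw [← h2, top_inf_eq] at h1
  have h3 := B.le_c i (B.d i j ⊓ (B.d j i)ᶜ)
  rw [h1, le_bot_iff, ← disjoint_iff] at h3
  exact disjoint_compl_right_iff.1 h3

theorem d_symm (i j : K) : B.d i j = B.d j i := le_antisymm (B.d_le_d_symm i j) (B.d_le_d_symm j i)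

theorem c_d_eq_top {i j : K} (hij : i ≠ j) : B.c i (B.d i j) = ⊤ := by
  have h := B.d_eq j j i hij hij
  rw [B.d_self, B.d_symm j i, inf_idem] at h
  exact h.symm

theorem d_inf_d_le (i j k : K) : B.d i j ⊓ B.d j k ≤ B.d i k := by
  rcases eq_or_ne j i with rfl | hi
  · exact inf_le_right
  rcases eq_or_ne j k with rfl | hk
  · exact inf_le_left
  rw [B.d_eq i k j hi hk]
  exact B.le_c j _

/-- On the diagonal `d_ij` the operation `x ↦ c_i (d_ij · x)` is the identity. -/
theorem d_inf_c {i j : K} (hij : i ≠ j) (x : B.carrier) :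
    B.d i j ⊓ B.c i (B.d i j ⊓ x) = B.d i j ⊓ x := by
  refine le_antisymm ?_ (le_inf inf_le_left (B.le_c i _))
  refine le_inf inf_le_left ?_
  have h1 : B.d i j ⊓ xᶜ ⊓ B.c i (B.d i j ⊓ x) ≤ ⊥ := by
    rw [← B.c_d_compl i j x hij, inf_comm]
    exact inf_le_inf_left _ (B.le_c i _)
  rw [inf_right_comm] at h1
  exact disjoint_compl_right_iff.1 (disjoint_iff.2 (le_bot_iff.1 h1))

open Classical in
/-- The replacement operations of a cylindric algebra: `s^i_j x = c_i (d_ij · x)` for `i ≠ j`. -/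
noncomputable def sub (i j : K) (x : B.carrier) : B.carrier :=
  if i = j then x else B.c i (B.d i j ⊓ x)

theorem sub_self (i : K) (x : B.carrier) : B.sub i i x = x := if_pos rfl

theorem sub_of_ne {i j : K} (h : i ≠ j) (x : B.carrier) : B.sub i j x = B.c i (B.d i j ⊓ x) :=
  if_neg h

theorem c_sub {i j : K} (h : i ≠ j) (x : B.carrier) : B.c i (B.sub i j x) = B.sub i j x := by
  rw [B.sub_of_ne h, c_c]

theorem sub_c (i j : K) (x : B.carrier) : B.sub i j (B.c i x) = B.c i x := by
  rcases eq_or_ne i j with rfl | h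
  · exact B.sub_self _ _
  · rw [B.sub_of_ne h, B.c_inf_c, B.c_d_eq_top h, top_inf_eq]

theorem sub_sub_of_ne {i j k l : K} (hij : i ≠ j) (hkl : k ≠ l) (hki : k ≠ i) (hkj : k ≠ j)
    (x : B.carrier) : B.sub i j (B.sub k l x) = B.c i (B.c k (B.d i j ⊓ B.d k l ⊓ x)) := by
  rw [B.sub_of_ne hij, B.sub_of_ne hkl, inf_assoc, B.c_inf_of_fixed (B.c_d hki hkj)]

/-- Replacements preserve complements: `c_d_compl` makes the images of `x` and `xᶜ` disjoint, and
they cover `⊤` because `c_i d_ij = ⊤`. -/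
theorem sub_compl (i j : K) (x : B.carrier) : B.sub i j xᶜ = (B.sub i j x)ᶜ := by
  rcases eq_or_ne i j with rfl | h
  · simp only [sub_self]
  rw [B.sub_of_ne h, B.sub_of_ne h]
  refine (IsCompl.of_eq (B.c_d_compl i j x h) ?_).compl_eq.symm
  rw [← c_sup, ← inf_sup_left, sup_compl_eq_top, inf_top_eq, B.c_d_eq_top h]

theorem sub_sup (i j : K) (x y : B.carrier) : B.sub i j (x ⊔ y) = B.sub i j x ⊔ B.sub i j y := by
  rcases eq_or_ne i j with rfl | h
  · simp only [sub_self]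
  rw [B.sub_of_ne h, B.sub_of_ne h, B.sub_of_ne h, inf_sup_left, c_sup]

theorem sub_inf (i j : K) (x y : B.carrier) : B.sub i j (x ⊓ y) = B.sub i j x ⊓ B.sub i j y := by
  have h := B.sub_sup i j xᶜ yᶜ
  rw [← compl_inf, sub_compl, sub_compl, sub_compl, ← compl_inf] at h
  exact compl_injective h

/-- Away from coinciding indices this is transitivity of the diagonals,
`d_li · d_jl = d_li · d_ji`. -/
theorem sub_sub (i j l : K) (x : B.carrier) :
    B.sub l i (B.sub j l x) = B.sub l i (B.sub j i x) := by
  rcases eq_or_ne l i with rfl | hli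
  · rfl
  rcases eq_or_ne j l with rfl | hjl
  · rw [sub_self, B.sub_of_ne hli x, sub_c]
  rcases eq_or_ne j i with rfl | hji
  · rw [sub_self, B.sub_of_ne hli, B.sub_of_ne hli, B.sub_of_ne hjl, B.d_symm l j,
      B.d_inf_c hjl]
  rw [B.sub_sub_of_ne hli hjl hjl hji, B.sub_sub_of_ne hli hji hjl hji]
  congr 3
  refine le_antisymm (le_inf inf_le_left ?_) (le_inf inf_le_left ?_)
  · rw [inf_comm]
    exact B.d_inf_d_le j l i
  · rw [inf_comm, B.d_symm l i]
    exact B.d_inf_d_le j i l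

/-- The substitution algebra reduct of a cylindric algebra. -/
noncomputable def toSubstitutionAlgebra : SubstitutionAlgebra.{u, w} K where
  carrier := B.carrier
  c := B.c
  s := B.sub
  c_bot := B.c_bot
  le_c := B.le_c
  c_inf_c := B.c_inf_c
  c_comm := B.c_comm
  s_self := B.sub_self
  s_inf := B.sub_inf
  s_compl := B.sub_compl
  s_c := B.sub_c
  c_s i j x h := B.c_sub h x
  s_c_comm i j k x hi hj := by
    rcases eq_or_ne i j with rfl | h
    · simp only [sub_self]
    rw [B.sub_of_ne h, B.sub_of_ne h, B.c_comm, B.c_inf_of_fixed (B.c_d hi hj)]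
  c_s_swap i j x := by
    rcases eq_or_ne i j with rfl | h
    · rfl
    rw [B.sub_of_ne h, B.sub_of_ne h.symm, B.c_comm, B.d_symm]
  s_s_comm i j k l x hij hik hil hjk hjl hkl := by
    rw [B.sub_sub_of_ne hij.symm hkl.symm hjl.symm hil.symm,
      B.sub_sub_of_ne hkl.symm hij.symm hjl hjk, B.c_comm, inf_comm (B.d j i)]
  s_s := B.sub_sub

end CylindricAlgebra

namespace WeakSpace

theorem cyl_diag_inter {I : Type u} {F : Type v} [Zero F] {i j : I} (hij : i ≠ j)
    (X : Set (I →₀ F)) : cyl i (diag F i j ∩ X) = repl i j X := by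
  classical
  ext s
  rw [mem_cyl_iff_update, mem_repl]
  constructor
  · rintro ⟨a, ha, haX⟩
    have ha' : a = s j := by simpa [diag, hij.symm] using ha
    exact ha' ▸ haX
  · exact fun h => ⟨s j, by simp [diag, hij.symm], h⟩

theorem isNeatReduct_rdSC_of_rdCA {α β : Ordinal.{u}} {F : Type v} [Zero F]
    {G : Set (Set (Iio α →₀ F))} (h : α ≤ β) (hN : (rdCA G).IsNeatReduct β h) :
    (rdSC G).IsNeatReduct β h := by
  obtain ⟨B, f, hc, hd⟩ := hN
  refine ⟨B.toSubstitutionAlgebra, f, hc, fun i j (X : (rdCA G).carrier) => ?_⟩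
  rcases eq_or_ne i j with rfl | hij
  · exact (congrArg f ((rdSC G).s_self i X)).trans
      (SubstitutionAlgebra.s_self (B.toSubstitutionAlgebra.neatReduct h) i (f X)).symm
  have h1 : (rdSC G).s i j X = (rdCA G).c i ((rdCA G).d i j ⊓ X) :=
    Subtype.ext (cyl_diag_inter hij X.1).symm
  have h2 : f ((rdCA G).c i ((rdCA G).d i j ⊓ X)) =
      (B.neatReduct h).c i ((B.neatReduct h).d i j ⊓ f X) := by
    rw [hc, f.map_inf, hd]
  exact (congrArg f h1).trans
    (h2.trans (Subtype.ext (B.sub_of_ne ((dimIncl_injective h).ne hij) _).symm))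

end WeakSpace

/-! ### Atom structures of set algebras containing all points -/

namespace AtomStructure

variable {I : Type u}

theorem Isomorphic.refl (S : AtomStructure.{u, w} I) : S.Isomorphic S :=
  ⟨Equiv.refl _, fun _ _ _ => Iff.rfl, fun _ _ _ => Iff.rfl⟩

theorem Isomorphic.symm {S S' : AtomStructure.{u, w} I} (h : S.Isomorphic S') :
    S'.Isomorphic S := by
  obtain ⟨f, hT, hE⟩ := h
  exact ⟨f.symm, fun i a b => by simp [hT], fun i j a => by simp [hE]⟩

theorem Isomorphic.trans {S S' S'' : AtomStructure.{u, w} I} (h : S.Isomorphic S')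
    (h' : S'.Isomorphic S'') : S.Isomorphic S'' := by
  obtain ⟨f, hT, hE⟩ := h
  obtain ⟨f', hT', hE'⟩ := h'
  exact ⟨f.trans f', fun i a b => by rw [hT, hT']; rfl, fun i j a => by rw [hE, hE']; rfl⟩

end AtomStructure

namespace WeakSpace

section Points

variable {I : Type u} {F : Type v} [Zero F]

variable (I F) in
/-- The atom structure of the set algebras on the weak space that contain all points. -/
def pointStructure : AtomStructure.{u, max u v} I where
  carrier := I →₀ F
  T i s t := ∀ j, j ≠ i → s j = t j
  E i j s := s i = s j

variable {G : Set (Set (I →₀ F))}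

/-- A point of the weak space as an atom of a set algebra containing all points. -/
def point (hG : ∀ s, Generated G {s}) (s : I →₀ F) : (rdCA G).carrier := ⟨{s}, hG s⟩

theorem point_le (hG : ∀ s, Generated G {s}) {s : I →₀ F} {X : (rdCA G).carrier} :
    point hG s ≤ X ↔ s ∈ X.1 :=
  Set.singleton_subset_iff (s := X.1)

theorem isAtom_point (hG : ∀ s, Generated G {s}) (s : I →₀ F) : IsAtom (point hG s) := by
  constructor
  · intro h
    exact Set.singleton_ne_empty s (congrArg Subtype.val h)
  · intro X hX
    have h : X.1 ⊂ {s} := hX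
    exact Subtype.ext (Set.ssubset_singleton_iff.1 h)

theorem exists_point_le (hG : ∀ s, Generated G {s}) {X : (rdCA G).carrier} (hX : X ≠ ⊥) :
    ∃ s, point hG s ≤ X := by
  obtain ⟨s, hs⟩ : X.1.Nonempty :=
    Set.nonempty_iff_ne_empty.2 fun h => hX (Subtype.ext h)
  exact ⟨s, (point_le hG).2 hs⟩

theorem isAtomic_rdCA (hG : ∀ s, Generated G {s}) : IsAtomic (rdCA G).carrier :=
  ⟨fun _ => or_iff_not_imp_left.2 fun hX =>
    let ⟨s, hs⟩ := exists_point_le hG hX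
    ⟨point hG s, isAtom_point hG s, hs⟩⟩

theorem pointStructure_isomorphic (hG : ∀ s, Generated G {s}) :
    (pointStructure I F).Isomorphic (rdCA G).atomStructure := by
  refine ⟨Equiv.ofBijective (fun s => ⟨point hG s, isAtom_point hG s⟩) ⟨?_, ?_⟩, ?_, ?_⟩
  · intro s t h
    exact Set.singleton_injective (congrArg (fun a => a.1.1) h)
  · rintro ⟨X, hX⟩
    obtain ⟨s, hs⟩ := exists_point_le hG hX.1
    exact ⟨s, Subtype.ext ((hX.le_iff.1 hs).resolve_left (isAtom_point hG _).1)⟩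
  · intro i s t
    refine Iff.trans ?_ (point_le hG (X := (rdCA G).c i (point hG t))).symm
    constructor
    · exact fun h => ⟨t, rfl, h⟩
    · rintro ⟨_, rfl, h⟩
      exact h
  · exact fun i j s => (point_le hG (X := (rdCA G).d i j)).symm

end Points

/-! ### The full set algebra is a neat reduct -/

section Full

variable {α β : Ordinal.{u}} {F : Type v} [Zero F]

theorem mem_of_eq_below {X : Set (Iio β →₀ F)} (hX : ∀ k : Iio β, α ≤ k.1 → cyl k X = X)
    {s t : Iio β →₀ F} (hst : ∀ j : Iio β, j.1 < α → s j = t j) (hs : s ∈ X) : t ∈ X := by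
  classical
  -- Change `s` into `t` on the finitely many coordinates where they can differ, one at a time.
  have key : ∀ D : Finset (Iio β), ∀ r : Iio β →₀ F, (∀ j, j.1 < α → r j = t j) →
      (∀ j, j ∉ D → r j = t j) → r ∈ X → t ∈ X := by
    intro D
    induction D using Finset.induction_on with
    | empty =>
      intro r _ hr hrX
      have : r = t := Finsupp.ext fun j => hr j (by simp)
      exact this ▸ hrX
    | insert k D _ ih =>
      intro r hr hrD hrX
      by_cases hk : k.1 < α
      · refine ih r hr (fun j hj => ?_) hrX
        by_cases hjk : j = k
        · exact hr j (hjk ▸ hk)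
        · exact hrD j (by simp [hj, hjk])
      refine ih (r.update k (t k)) (fun j hj => ?_) (fun j hj => ?_) ?_
      · have : j ≠ k := fun h => hk (h ▸ hj)
        simp [this, hr j hj]
      · by_cases hjk : j = k
        · simp [hjk]
        · simp [hjk, hrD j (by simp [hj, hjk])]
      · rw [← hX k (not_lt.1 hk)]
        exact ⟨r, hrX, fun j hj => by simp [hj]⟩
  refine key (s.support ∪ t.support) s hst (fun j hj => ?_) hs
  simp only [Finset.mem_union, Finsupp.mem_support_iff, not_or, not_not] at hj
  rw [hj.1, hj.2]

/-- The restriction of a sequence of length `β` to the length `α`. -/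
noncomputable def restrict (h : α ≤ β) (s : Iio β →₀ F) : Iio α →₀ F :=
  s.comapDomain (dimIncl h) (dimIncl_injective h).injOn

/-- The extension of a sequence of length `α` to the length `β` by zeros. -/
noncomputable def extend (h : α ≤ β) (s : Iio α →₀ F) : Iio β →₀ F :=
  s.embDomain ⟨dimIncl h, dimIncl_injective h⟩

theorem restrict_apply (h : α ≤ β) (s : Iio β →₀ F) (i : Iio α) :
    restrict h s i = s (dimIncl h i) := rfl

theorem extend_apply (h : α ≤ β) (s : Iio α →₀ F) (i : Iio α) :
    extend h s (dimIncl h i) = s i :=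
  Finsupp.embDomain_apply_self ⟨dimIncl h, dimIncl_injective h⟩ s i

theorem restrict_extend (h : α ≤ β) (s : Iio α →₀ F) : restrict h (extend h s) = s :=
  Finsupp.ext fun i => by rw [restrict_apply, extend_apply]

theorem cyl_preimage_restrict (h : α ≤ β) {k : Iio β} (hk : α ≤ k.1) (X : Set (Iio α →₀ F)) :
    cyl k (restrict h ⁻¹' X) = restrict h ⁻¹' X := by
  refine Subset.antisymm ?_ (subset_cyl _ _)
  rintro s ⟨t, ht, hst⟩
  have : restrict h s = restrict h t :=
    Finsupp.ext fun i => hst _ (ne_dimIncl h hk i).symm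
  rwa [mem_preimage, this]

theorem cyl_preimage_restrict_dimIncl (h : α ≤ β) (i : Iio α) (X : Set (Iio α →₀ F)) :
    cyl (dimIncl h i) (restrict h ⁻¹' X) = restrict h ⁻¹' cyl i X := by
  classical
  ext s
  have key : ∀ a, restrict h (s.update (dimIncl h i) a) = (restrict h s).update i a := by
    intro a
    ext j
    by_cases hj : j = i
    · simp [hj, restrict_apply]
    · simp [hj, restrict_apply, (dimIncl_injective h).ne hj]
  simp only [mem_cyl_iff_update, mem_preimage, key]

/-- The algebra of all subsets of the weak space of dimension `α` is a neat reduct of the one of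
dimension `β`: as sequences have finite support, the subsets closed under the cylindrifications
from `α` on are the preimages under restriction. -/
theorem isNeatReduct_rdCA_univ (h : α ≤ β) :
    (rdCA (univ : Set (Set (Iio α →₀ F)))).IsNeatReduct β h := by
  have hgen : ∀ {γ : Ordinal.{u}} (X : Set (Iio γ →₀ F)), Generated univ X := fun X =>
    Generated.basic X (mem_univ X)
  let f : (rdCA (univ : Set (Set (Iio α →₀ F)))).carrier ≃
      ((rdCA (univ : Set (Set (Iio β →₀ F)))).neatReduct h).carrier :=
    { toFun := fun X => ⟨⟨restrict h ⁻¹' X.1, hgen _⟩, fun k hk =>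
        Subtype.ext (cyl_preimage_restrict h hk X.1)⟩
      invFun := fun Y => ⟨extend h ⁻¹' Y.1.1, hgen _⟩
      left_inv := fun X => Subtype.ext (by
        change extend h ⁻¹' (restrict h ⁻¹' X.1) = X.1
        ext s
        rw [mem_preimage, mem_preimage, restrict_extend])
      right_inv := fun Y => Subtype.ext (Subtype.ext (by
        change restrict h ⁻¹' (extend h ⁻¹' Y.1.1) = Y.1.1
        have hY : ∀ k : Iio β, α ≤ k.1 → cyl k Y.1.1 = Y.1.1 := fun k hk =>
          congrArg Subtype.val (Y.2 k hk)
        have hres : ∀ (s : Iio β →₀ F) (j : Iio β), j.1 < α →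
            extend h (restrict h s) j = s j := fun s j hj =>
          extend_apply h (restrict h s) ⟨j.1, hj⟩
        ext s
        exact ⟨mem_of_eq_below hY (hres s), mem_of_eq_below hY fun j hj => (hres s j hj).symm⟩)) }
  refine ⟨_, ⟨f, ?_⟩, ?_, ?_⟩
  · intro X Y
    constructor
    · intro hXY s hs
      have h1 : extend h s ∈ restrict h ⁻¹' X.1 := by rwa [mem_preimage, restrict_extend]
      have h2 : extend h s ∈ restrict h ⁻¹' Y.1 := hXY h1
      rwa [mem_preimage, restrict_extend] at h2
    · intro hXY s hs
      exact hXY hs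
  · intro i X
    exact Subtype.ext (Subtype.ext (cyl_preimage_restrict_dimIncl h i X.1).symm)
  · intro i j
    exact Subtype.ext (Subtype.ext rfl)

theorem isWeaklyNeat_rdCA {G : Set (Set (Iio α →₀ F))} (hG : ∀ s, Generated G {s}) :
    (rdCA G).atomStructure.IsWeaklyNeat := by
  have huniv : ∀ s : Iio α →₀ F, Generated univ {s} := fun s => Generated.basic _ (mem_univ _)
  exact ⟨rdCA univ, ⟨isAtomic_rdCA huniv,
    (pointStructure_isomorphic huniv).symm.trans (pointStructure_isomorphic hG)⟩,
    isNeatReduct_rdCA_univ _⟩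

end Full

/-! ### The algebra generated by the hyperplane `y` and its points -/

/-- A point is the intersection of the cylinders in two directions over points of a hyperplane
that depends on both coordinates. -/
theorem generated_singleton_of_hyperplane {I : Type u} {F : Type v} [Field F]
    {G : Set (Set (I →₀ F))} (φ : (I →₀ F) →ₗ[F] F) (a : F)
    (hφ : ∀ i, φ (Finsupp.single i 1) ≠ 0) (hG : ∀ s, φ s = a → Generated G {s})
    {i j : I} (hij : i ≠ j) (s : I →₀ F) : Generated G {s} := by
  have key : ∀ k, Generated G (cyl k {s}) := by
    intro k
    obtain ⟨t, ht, hst⟩ := (cyl_hyperplane φ a (hφ k)).ge (mem_univ s)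
    have : cyl k {s} = cyl k {t} := by
      rw [← cyl_cyl k {s}, ← cyl_cyl k {t}]
      refine Subset.antisymm (cyl_mono k ?_) (cyl_mono k ?_)
      · rintro _ ⟨_, rfl, hr⟩
        exact ⟨t, rfl, fun j hj => (hr j hj).trans (hst j hj)⟩
      · rintro _ ⟨_, rfl, hr⟩
        exact ⟨s, rfl, fun j hj => (hr j hj).trans (hst j hj).symm⟩
    rw [this]
    exact Generated.cyl k _ (hG t ht)
  rw [← cyl_singleton_inter_cyl_singleton hij s]
  exact Generated.inter _ _ (key i) (key j)

end WeakSpace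

section Planes

variable {α : Ordinal.{u}} (hα : 1 < α) {F : Type v} [Field F]

variable (α F) in
/-- The functional `s ↦ ∑_{i>0} s_i - s_0`. -/
noncomputable def functionalY : (Iio α →₀ F) →ₗ[F] F :=
  Finsupp.linearCombination F fun i => if 0 < i.1 then 1 else -1

variable (α F) in
/-- The functional `s ↦ s_1 + 2 ∑_{i>1} s_i - s_0`. -/
noncomputable def functionalW : (Iio α →₀ F) →ₗ[F] F :=
  Finsupp.linearCombination F fun i => if 1 < i.1 then 2 else if 0 < i.1 then 1 else -1

theorem zero_ne_one_index :
    (⟨0, zero_lt_one.trans hα⟩ : Iio α) ≠ ⟨1, hα⟩ := fun h =>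
  zero_ne_one (congrArg Subtype.val h)

theorem functionalY_apply (s : Iio α →₀ F) :
    functionalY α F s =
      (∑ i ∈ s.support with 0 < i.1, s i) - s ⟨0, zero_lt_one.trans hα⟩ := by
  classical
  have h0 : s ⟨0, zero_lt_one.trans hα⟩ =
      ∑ i ∈ s.support, if i = ⟨0, zero_lt_one.trans hα⟩ then s i else 0 := by
    rw [Finset.sum_ite_eq']
    simp
  rw [functionalY, Finsupp.linearCombination_apply, Finsupp.sum, Finset.sum_filter, h0,
    ← Finset.sum_sub_distrib]
  refine Finset.sum_congr rfl fun i _ => ?_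
  rcases eq_or_ne i ⟨0, zero_lt_one.trans hα⟩ with rfl | hi
  · simp
  · have : 0 < i.1 := pos_iff_ne_zero.2 fun h => hi (Subtype.ext h)
    simp [this, hi]

theorem functionalW_apply (s : Iio α →₀ F) :
    functionalW α F s = s ⟨1, hα⟩ + 2 * (∑ i ∈ s.support with 1 < i.1, s i) -
      s ⟨0, zero_lt_one.trans hα⟩ := by
  classical
  have h : ∀ j, s j = ∑ i ∈ s.support, if i = j then s i else 0 := by
    intro j
    rw [Finset.sum_ite_eq']
    simp
  rw [functionalW, Finsupp.linearCombination_apply, Finsupp.sum, Finset.sum_filter, h ⟨1, hα⟩,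
    h ⟨0, zero_lt_one.trans hα⟩, Finset.mul_sum, ← Finset.sum_add_distrib,
    ← Finset.sum_sub_distrib]
  refine Finset.sum_congr rfl fun i _ => ?_
  rcases eq_or_ne i ⟨0, zero_lt_one.trans hα⟩ with rfl | hi
  · simp [zero_ne_one_index hα]
  have h0 : 0 < i.1 := pos_iff_ne_zero.2 fun h => hi (Subtype.ext h)
  rcases eq_or_ne i ⟨1, hα⟩ with rfl | hi'
  · simp [(zero_ne_one_index hα).symm]
  have h1 : 1 < i.1 :=
    lt_of_le_of_ne (Order.one_le_iff_pos.2 h0) fun h => hi' (Subtype.ext h.symm)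
  simp [h1, hi, hi', mul_comm]

theorem planeY_eq : planeY α hα F = {s | functionalY α F s = 1} := by
  ext s
  rw [planeY, mem_ofPred_eq, mem_ofPred_eq, functionalY_apply hα, sub_eq_iff_eq_add, eq_comm,
    add_comm]

theorem planeW_eq : planeW α hα F = {s | functionalW α F s = 2} := by
  ext s
  rw [planeW, mem_ofPred_eq, mem_ofPred_eq, functionalW_apply hα, sub_eq_iff_eq_add, eq_comm,
    add_comm _ (2 : F)]

theorem functionalY_single (i : Iio α) (a : F) :
    functionalY α F (Finsupp.single i a) = if 0 < i.1 then a else -a := by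
  rw [functionalY, Finsupp.linearCombination_single]
  split_ifs <;> simp

theorem functionalW_single (i : Iio α) (a : F) :
    functionalW α F (Finsupp.single i a) =
      if 1 < i.1 then 2 * a else if 0 < i.1 then a else -a := by
  rw [functionalW, Finsupp.linearCombination_single]
  split_ifs <;> simp [mul_comm]

theorem functionalY_single_one_ne_zero (i : Iio α) :
    functionalY α F (Finsupp.single i 1) ≠ 0 := by
  rw [functionalY_single]
  split_ifs <;> simp

theorem generated_planeY : WeakSpace.Generated (generators α hα F) (planeY α hα F) :=
  .basic _ (mem_insert _ _)

theorem generated_singleton (s : Iio α →₀ F) :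
    WeakSpace.Generated (generators α hα F) {s} := by
  refine WeakSpace.generated_singleton_of_hyperplane (functionalY α F) 1
    functionalY_single_one_ne_zero (fun t ht => .basic _ (Or.inr ⟨t, ?_, rfl⟩))
    (zero_ne_one_index hα) s
  rwa [planeY_eq]

/-- The hyperplane `w` is the composition of `y` with itself: the intermediate value `z`
satisfies `z = s_0 + 1 - ∑_{i>1} s_i` and `z + 1 = s_1 + ∑_{i>1} s_i`. -/
theorem planeW_eq_comp : planeW α hα F =
    {s | ∃ z, s.update ⟨1, hα⟩ z ∈ planeY α hα F ∧
      s.update ⟨0, zero_lt_one.trans hα⟩ z ∈ planeY α hα F} := by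
  classical
  have hupd : ∀ (s : Iio α →₀ F) i z, functionalY α F (s.update i z) =
      functionalY α F s + if 0 < i.1 then z - s i else -(z - s i) := by
    intro s i z
    rw [← functionalY_single, ← map_add]
    congr 1
    ext j
    rcases eq_or_ne j i with rfl | hj
    · simp
    · simp [hj]
  have hW : functionalW α F = (2 : F) • functionalY α F +
      Finsupp.lapply ⟨0, zero_lt_one.trans hα⟩ - Finsupp.lapply ⟨1, hα⟩ := by
    refine Finsupp.lhom_ext fun i a => ?_
    simp only [LinearMap.sub_apply, LinearMap.add_apply, LinearMap.smul_apply,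
      Finsupp.lapply_apply, functionalY_single, functionalW_single, smul_eq_mul]
    rcases eq_or_ne i ⟨0, zero_lt_one.trans hα⟩ with rfl | hi
    · simp [(zero_ne_one_index hα).symm]
      ring
    have h0 : 0 < i.1 := pos_iff_ne_zero.2 fun h => hi (Subtype.ext h)
    rcases eq_or_ne i ⟨1, hα⟩ with rfl | hi'
    · simp [zero_ne_one_index hα]
      ring
    have h1 : 1 < i.1 :=
      lt_of_le_of_ne (Order.one_le_iff_pos.2 h0) fun h => hi' (Subtype.ext h.symm)
    simp [h0, h1, hi.symm, hi'.symm]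
  ext s
  rw [planeW_eq, planeY_eq]
  simp only [mem_ofPred_eq, hupd, hW, LinearMap.sub_apply, LinearMap.add_apply,
    LinearMap.smul_apply, Finsupp.lapply_apply, smul_eq_mul, zero_lt_one, lt_irrefl, if_true,
    if_false]
  constructor
  · intro h
    refine ⟨1 - functionalY α F s + s ⟨1, hα⟩, by ring, by linear_combination h⟩
  · rintro ⟨z, h1, h2⟩
    linear_combination h1 + h2

variable [CharZero F]

theorem isTame_of_mem_generators {X : Set (Iio α →₀ F)} (hX : X ∈ generators α hα F) :
    WeakSpace.IsTame X := by
  rcases hX with rfl | ⟨s, _, rfl⟩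
  · rw [planeY_eq]
    refine WeakSpace.IsBasic.isTame ⟨WeakSpace.isFlat_hyperplane _ _, Or.inr fun i hi => ?_⟩
    rw [mem_ofPred_eq, functionalY_single] at hi
    split_ifs at hi
    · norm_num at hi
    · have : (3 : F) = 0 := by linear_combination -hi
      norm_num at this
  · exact WeakSpace.isTame_singleton (zero_ne_one_index hα) s

theorem not_generated_planeW : ¬ WeakSpace.Generated (generators α hα F) (planeW α hα F) := by
  intro h
  have htame := h.isTame fun X => isTame_of_mem_generators hα
  rw [planeW_eq] at htame
  refine WeakSpace.not_isTame_hyperplane (functionalW α F) 2 (fun i => ?_) (i := ⟨1, hα⟩) ?_ htame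
  · rw [functionalW_single]
    split_ifs <;> simp
  · simp [functionalW_single]

theorem not_isNeatReduct_rdSC {β : Ordinal.{u}} (h : α < β) :
    ¬ (WeakSpace.rdSC (generators α hα F)).IsNeatReduct β h.le := by
  intro hN
  refine not_generated_planeW hα (F := F) ?_
  rw [planeW_eq_comp]
  exact WeakSpace.Generated.comp (generated_singleton hα) h hN (zero_ne_one_index hα)
    (generated_planeY hα)

theorem not_isStronglyNeat_rdCA :
    ¬ (WeakSpace.rdCA (generators α hα F)).atomStructure.IsStronglyNeat := fun h =>
  not_isNeatReduct_rdSC hα (lt_add_of_pos_right α Ordinal.omega0_pos)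
    (WeakSpace.isNeatReduct_rdSC_of_rdCA _
      (h _ ⟨WeakSpace.isAtomic_rdCA (generated_singleton hα), .refl _⟩))

end Planes

theorem mainTheorem5 (α : Ordinal.{u}) (hα : 1 < α) :
    (∃ S : AtomStructure.{u + 1, u + 1} (Set.Iio α), S.IsWeaklyNeat ∧ ¬ S.IsStronglyNeat) ∧
    ∀ (F : Type v) [Field F] [CharZero F],
      IsAtomic (WeakSpace.rdCA (generators α hα F)).carrier ∧
      (WeakSpace.rdCA (generators α hα F)).atomStructure.IsWeaklyNeat ∧
      ¬ (WeakSpace.rdCA (generators α hα F)).atomStructure.IsStronglyNeat ∧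
      ¬ (WeakSpace.rdSC (generators α hα F)).IsNeatReduct (α + 1) le_self_add ∧
      ¬ WeakSpace.Generated (generators α hα F) (planeW α hα F) := by
  refine ⟨⟨(WeakSpace.rdCA (generators α hα ℚ)).atomStructure,
    WeakSpace.isWeaklyNeat_rdCA (generated_singleton hα), not_isStronglyNeat_rdCA hα⟩,
    fun F _ _ => ⟨WeakSpace.isAtomic_rdCA (generated_singleton hα),
    WeakSpace.isWeaklyNeat_rdCA (generated_singleton hα), not_isStronglyNeat_rdCA hα,
    not_isNeatReduct_rdSC hα (lt_add_of_pos_right α zero_lt_one), not_generated_planeW hα⟩⟩
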